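/- **Definitions.** *$(p,q)$-Fair Clustering.* An instance consists of a metric space $([m],d)$, weight functions $w_1,\dots,w_n:[m]\to\mathbb{R}_{\ge 0}$ (all numbers rational, given in binary) and an integer $1\le k\le m$. The goal is to find $C\subseteq[m]$ with $|C|=k$ minimizing $$\mathrm{cost}_{p,q}(C)=\Big(\sum_{i=1}^n\Big(\sum_{j=1}^m w_i(j)\,d(j,C)^p\Big)^{q/p}\Big)^{1/q},\qquad d(j,C)=\min_{j'\in C}d(j,j').$$ For $\rho:\mathbb{N}\to\mathbb{R}$, a polynomial-time $\rho(m)$-approximation algorithm is a polynomial-time algorithm that on every instance with $m$ points outputs a set of $k$ centers of cost at most $\rho(m)$ times the optimum (with probability at least $2/3$ over its coins, if it is randomized). *Dense versus Random.* For $0<\varepsilon<\delta<1$ consider inputs consisting of an integer $s$ and $m$ sets $S_1,\dots,S_m\subseteq[n]$, where $s=m^{\varepsilon}$ and $n=10\,m^{\varepsilon}\ln m$ (here and below, non-integral quantities are rounded down), of one of two kinds. - *Random:* each $S_j$ is the set of $10\ln m$ elements of $[n]$ drawn independently and uniformly at random, independently for all $j$. - *Dense:* the sets are arbitrary, except that there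 are $J\subseteq[m]$ and $I\subseteq[n]$ with $|J|=s$, $|I|\le(10s\ln m)^{\delta}$ and $S_j\subseteq I$ for all $j\in J$. The Dense versus Random Conjecture holds for $\varepsilon,\delta$ (with $s=m^\varepsilon$) if there is no polynomial-time algorithm that, for all sufficiently large $m$, answers "dense" on every Dense input (with probability at least $2/3$ over its coins, if it is randomized), and that answers "random" on a Random input with probability $1-o(1)$ as $m\to\infty$ (over the input and its coins). **Theorem.** Let $1\le q\le p<\infty$ and $0<\varepsilon<\delta<1$ be constants with $\varepsilon\le\frac12$, and suppose that the Dense versus Random Conjecture holds for $\varepsilon,\delta$ (with $s=m^\varepsilon$). Then $(p,q)$-Fair Clustering is hard to approximate within less than $m^{\varepsilon(1-\delta)(p-q)/(pq)}$: for every $\rho:\mathbb{N}\to\mathbb{R}$ with $\rho(m)<m^{\varepsilon(1-\delta)(p-q)/(pq)}$ for all sufficiently large $m$, there is no polynomial-time $\rho(m)$-approximation algorithm for $(p,q)$-Fair Clustering. This holds both when "algorithm" means deterministic algorithm throughout and when it means randomized algorithm throughout. -/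

import Mathlib

open Filter Topology MeasureTheory

namespace FairClustering

/-! ### The model of computation

Structured programs that manipulate binary trees, with coin tossing.  A program has finitely many
variables (indexed by natural numbers) that hold trees; an assignment is charged one plus the size
of the tree it stores, every test and every coin toss is charged one.  Since every stored tree has
been paid for, these programs and (probabilistic) Turing machines simulate each other with a
polynomial overhead. -/

/-- The data: binary trees without labels. -/
inductive Data : Type
  | nil : Data
  | node : Data → Data → Data

namespace Data

/-- The number of vertices of a tree. -/
def size : Data → ℕ
  | nil => 1
  | node a b => 1 + a.size + b.size

/-- The left subtree (`nil` for `nil`). -/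
def head : Data → Data
  | nil => nil
  | node a _ => a

/-- The right subtree (`nil` for `nil`). -/
def tail : Data → Data
  | nil => nil
  | node _ b => b

/-- Truth values: false is `nil`, true is the tree with one inner vertex. -/
def ofBool : Bool → Data
  | false => nil
  | true => node nil nil

/-- Lists of trees. -/
def ofList : List Data → Data
  | [] => nil
  | a :: l => node a (ofList l)

/-- Natural numbers in unary. -/
def ofUnary (n : ℕ) : Data := ofList (List.replicate n nil)

/-- Natural numbers in binary, least significant digit first. -/
def ofBinary (n : ℕ) : Data := ofList (n.bits.map ofBool)

/-- Non-negative rationals as reduced fractions of binary numbers. -/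
def ofNNRat (x : NNRat) : Data := node (ofBinary x.num) (ofBinary x.den)

/-- Subsets of `{0, …, m - 1}` as lists of `m` truth values. -/
def ofFinset {m : ℕ} (C : Finset (Fin m)) : Data :=
  ofList ((List.finRange m).map fun j => ofBool (decide (j ∈ C)))

end Data

/-- An assignment of trees to the variables. -/
abbrev Store : Type := ℕ → Data

/-- Expressions. -/
inductive Expr : Type
  | nil : Expr
  | var : ℕ → Expr
  | node : Expr → Expr → Expr
  | head : Expr → Expr
  | tail : Expr → Expr

/-- The value of an expression. -/
def Expr.eval (σ : Store) : Expr → Data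
  | .nil => Data.nil
  | .var x => σ x
  | .node a b => Data.node (a.eval σ) (b.eval σ)
  | .head a => (a.eval σ).head
  | .tail a => (a.eval σ).tail

/-- Programs. -/
inductive Program : Type
  | skip : Program
  | assign : ℕ → Expr → Program
  | toss : ℕ → Program
  | seq : Program → Program → Program
  | branch : Expr → Program → Program → Program
  | loop : Expr → Program → Program

/-- A program is deterministic if it contains no coin toss. -/
def Program.Deterministic : Program → Prop
  | .skip => True
  | .assign _ _ => True
  | .toss _ => False
  | .seq a b => a.Deterministic ∧ b.Deterministic
  | .branch _ a b => a.Deterministic ∧ b.Deterministic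
  | .loop _ a => a.Deterministic

/-- The state of a computation: the contents of the variables and the coins not yet tossed. -/
structure State : Type where
  store : Store
  coins : ℕ → Bool

/-- `Run c st st' t`: started in `st`, the program `c` halts in `st'` after `t` steps.  A branch or
a loop tests whether the value of its expression is different from `nil`. -/
inductive Run : Program → State → State → ℕ → Prop
  | skip (st : State) : Run .skip st st 1
  | assign (x : ℕ) (e : Expr) (st : State) :
      Run (.assign x e) st ⟨Function.update st.store x (e.eval st.store), st.coins⟩
        (1 + (e.eval st.store).size)
  | toss (x : ℕ) (st : State) :
      Run (.toss x) st
        ⟨Function.update st.store x (Data.ofBool (st.coins 0)), fun i => st.coins (i + 1)⟩ 1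
  | seq {a b : Program} {st st' st'' : State} {t t' : ℕ} :
      Run a st st' t → Run b st' st'' t' → Run (.seq a b) st st'' (t + t')
  | branch_true {e : Expr} {a b : Program} {st st' : State} {t : ℕ} :
      e.eval st.store ≠ Data.nil → Run a st st' t → Run (.branch e a b) st st' (1 + t)
  | branch_false {e : Expr} {a b : Program} {st st' : State} {t : ℕ} :
      e.eval st.store = Data.nil → Run b st st' t → Run (.branch e a b) st st' (1 + t)
  | loop_true {e : Expr} {a : Program} {st st' st'' : State} {t t' : ℕ} :
      e.eval st.store ≠ Data.nil → Run a st st' t → Run (.loop e a) st' st'' t' →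
        Run (.loop e a) st st'' (1 + t + t')
  | loop_false {e : Expr} {a : Program} {st : State} :
      e.eval st.store = Data.nil → Run (.loop e a) st st 1

/-- The initial state: the input is in variable `0`, all other variables are `nil`. -/
def initState (x : Data) (ω : ℕ → Bool) : State :=
  ⟨Function.update (fun _ => Data.nil) 0 x, ω⟩

/-- On input `x` and coins `ω`, the program halts after `t` steps with `y` in variable `0`. -/
def HaltsWith (c : Program) (x : Data) (ω : ℕ → Bool) (y : Data) (t : ℕ) : Prop :=
  ∃ st : State, Run c (initState x ω) st t ∧ st.store 0 = y

/-- On input `x` and coins `ω`, the program halts with output `y`. -/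
def Outputs (c : Program) (x : Data) (ω : ℕ → Bool) (y : Data) : Prop :=
  ∃ t : ℕ, HaltsWith c x ω y t

/-- On all inputs from `X` and for all coins, the program halts within a number of steps that is
polynomial in the size of the input. -/
def PolyTimeOn (c : Program) (X : Set Data) : Prop :=
  ∃ P : Polynomial ℕ, ∀ x ∈ X, ∀ ω : ℕ → Bool,
    ∃ (y : Data) (t : ℕ), HaltsWith c x ω y t ∧ t ≤ P.eval x.size

/-- The law of an infinite sequence of independent fair coins. -/
noncomputable def coinMeasure : Measure (ℕ → Bool) :=
  Measure.infinitePi fun _ : ℕ => (PMF.uniformOfFintype Bool).toMeasure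

/-- The two usual notions of an efficient algorithm. -/
inductive Mode : Type
  | deterministic : Mode
  | randomized : Mode

/-- The programs that are admitted in each mode. -/
def Mode.Admits : Mode → Program → Prop
  | .deterministic, c => c.Deterministic
  | .randomized, _ => True

/-! ### Fair clustering -/

/-- An instance of fair clustering: a metric on `m` points, `n` weight functions and a number of
centers, with rational data. -/
structure Instance : Type where
  m : ℕ
  n : ℕ
  k : ℕ
  d : Fin m → Fin m → NNRat
  w : Fin n → Fin m → NNRat
  d_eq_zero : ∀ i j, d i j = 0 ↔ i = j
  d_comm : ∀ i j, d i j = d j i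
  d_triangle : ∀ i j l, d i l ≤ d i j + d j l
  one_le_k : 1 ≤ k
  k_le_m : k ≤ m

namespace Instance

/-- The distance of a point to a (non-empty) set of centers; the infimum is a minimum. -/
noncomputable def distTo (I : Instance) (j : Fin I.m) (C : Finset (Fin I.m)) : ℝ :=
  ⨅ c : C, (I.d j c : ℝ)

/-- The `ℓ_p`-cost of the group `i`. -/
noncomputable def groupCost (I : Instance) (p : ℝ) (C : Finset (Fin I.m)) (i : Fin I.n) : ℝ :=
  (∑ j : Fin I.m, (I.w i j : ℝ) * I.distTo j C ^ p) ^ (1 / p)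

/-- The `(ℓ_p, ℓ_q)`-cost. -/
noncomputable def cost (I : Instance) (p q : ℝ) (C : Finset (Fin I.m)) : ℝ :=
  (∑ i : Fin I.n, I.groupCost p C i ^ q) ^ (1 / q)

/-- `C` is a set of `k` centers whose cost is at most `ρ` times the optimum. -/
def IsApprox (I : Instance) (p q ρ : ℝ) (C : Finset (Fin I.m)) : Prop :=
  C.card = I.k ∧
    ∀ C' : Finset (Fin I.m), C'.card = I.k → I.cost p q C ≤ ρ * I.cost p q C'

/-- The input: `k` in unary (recall `k ≤ m`), the matrix of distances row by row, and, point by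
point, the list of the `n` weights of that point. -/
def encode (I : Instance) : Data :=
  Data.node (Data.ofUnary I.k) <| Data.node
    (Data.ofList ((List.finRange I.m).map fun i =>
      Data.ofList ((List.finRange I.m).map fun j => Data.ofNNRat (I.d i j))))
    (Data.ofList ((List.finRange I.m).map fun j =>
      Data.ofList ((List.finRange I.n).map fun i => Data.ofNNRat (I.w i j))))

end Instance

/-- `c` is a polynomial-time algorithm that on every instance with `m` points finds a
`ρ(m)`-approximate solution of `(p,q)`-fair clustering with probability at least `2/3`
(hence always, if `c` is deterministic). -/
def Approximates (c : Program) (p q : ℝ) (ρ : ℕ → ℝ) : Prop :=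
  PolyTimeOn c (Set.range Instance.encode) ∧
    ∀ I : Instance, 2 / 3 ≤ coinMeasure.real
      {ω | ∃ C : Finset (Fin I.m), I.IsApprox p q (ρ I.m) C ∧
        Outputs c I.encode ω (Data.ofFinset C)}

/-- No efficient algorithm approximates `(p,q)`-fair clustering within less than `f(m)`. -/
def HardToApproximateWithinLessThan (mode : Mode) (p q : ℝ) (f : ℕ → ℝ) : Prop :=
  ∀ ρ : ℕ → ℝ, (∀ᶠ m in atTop, ρ m < f m) →
    ¬ ∃ c : Program, mode.Admits c ∧ Approximates c p q ρ

/-! ### Dense versus random -/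

/-- The input of Min `s`-Union: the parameter `s` in unary (recall `s ≤ m`) and the list of the
`m` sets, each a list of `n` truth values. -/
def encodeMinUnion {m n : ℕ} (S : Fin m → Finset (Fin n)) (s : ℕ) : Data :=
  Data.node (Data.ofUnary s) (Data.ofList ((List.finRange m).map fun j => Data.ofFinset (S j)))

/-- The set of all inputs of Min `s`-Union. -/
def minUnionInputs : Set Data :=
  {x | ∃ (m n s : ℕ) (S : Fin m → Finset (Fin n)), 1 ≤ s ∧ s ≤ m ∧ x = encodeMinUnion S s}

/-- The size `n = 10 m^ε ln m` of the ground set. -/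
noncomputable def groundSize (ε : ℝ) (m : ℕ) : ℕ := ⌊10 * (m : ℝ) ^ ε * Real.log m⌋₊

/-- The number `10 ln m` of elements drawn for a random set. -/
noncomputable def drawCount (m : ℕ) : ℕ := ⌊10 * Real.log m⌋₊

/-- The parameter `s = m^ε`. -/
noncomputable def unionParam (ε : ℝ) (m : ℕ) : ℕ := ⌊(m : ℝ) ^ ε⌋₊

/-- The sets given by a table of draws: the set `j` consists of all `f j l`. -/
def drawnSets {m r n : ℕ} (f : Fin m → Fin r → Fin n) (j : Fin m) : Finset (Fin n) :=
  Finset.univ.image (f j)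

/-- The dense case: some `s` of the sets lie in one set of at most `(10 s ln m)^δ` elements. -/
def IsDense {m n : ℕ} (δ : ℝ) (s : ℕ) (S : Fin m → Finset (Fin n)) : Prop :=
  ∃ (J : Finset (Fin m)) (I : Finset (Fin n)), J.card = s ∧
    (I.card : ℝ) ≤ (10 * (s : ℝ) * Real.log m) ^ δ ∧ ∀ j ∈ J, S j ⊆ I

/-- The program answers "dense". -/
def Accepts (c : Program) (x : Data) (ω : ℕ → Bool) : Prop := Outputs c x ω (Data.ofBool true)

/-- The program answers "random". -/
def Rejects (c : Program) (x : Data) (ω : ℕ → Bool) : Prop := Outputs c x ω (Data.ofBool false)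

/-- The probability, over independent uniform draws and over the coins, that `c` answers "random"
on a random instance with `m` sets. -/
noncomputable def randomRejectProb (c : Program) (ε : ℝ) (s : ℕ → ℕ) (m : ℕ) : ℝ :=
  (∑ f : Fin m → Fin (drawCount m) → Fin (groundSize ε m),
      coinMeasure.real {ω | Rejects c (encodeMinUnion (drawnSets f) (s m)) ω}) /
    Fintype.card (Fin m → Fin (drawCount m) → Fin (groundSize ε m))

/-- `c` is a polynomial-time algorithm that, for all large `m`, answers "dense" on every dense
instance with probability at least `2/3` over its coins (hence always, if `c` is deterministic), and
that answers "random" on a random instance with probability `1 - o(1)`. -/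
def Distinguishes (c : Program) (ε δ : ℝ) (s : ℕ → ℕ) : Prop :=
  PolyTimeOn c minUnionInputs ∧
    (∀ᶠ m in atTop, ∀ S : Fin m → Finset (Fin (groundSize ε m)), IsDense δ (s m) S →
      2 / 3 ≤ coinMeasure.real {ω | Accepts c (encodeMinUnion S (s m)) ω}) ∧
    Tendsto (randomRejectProb c ε s) atTop (𝓝 1)

/-- The Dense versus Random Conjecture for the parameters `ε`, `δ` and `s = s(m)`: no efficient
algorithm distinguishes the two cases. -/
def DenseVersusRandom (mode : Mode) (ε δ : ℝ) (s : ℕ → ℕ) : Prop :=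
  ¬ ∃ c : Program, mode.Admits c ∧ Distinguishes c ε δ s

end FairClustering

/-!
Take the `m` sets as points with the uniform metric, and every element `i` as a group with weight
`1` on the sets that contain it.  If the centers leave out the `s` sets in `J`, the `q`-th power of
the cost is `∑ i, deg_J(i) ^ (q / p)`, where `deg_J(i)` counts the sets in `J` that contain `i`.
Every positive degree is at least `1`, so this is at least `|⋃_J S_j|`.  If `S_j ⊆ I` for `j ∈ J`,
it is at most `|I| ^ (1 - q / p) * n ^ (q / p)` by Hölder's inequality: the degrees sum to at most
`n`, because a set of more than `n / s` elements never occurs in a Random input and reveals a Dense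
one at once.  On a Dense input, with `n ≈ m ^ ε * L` and `L = 10 * log m`, a solution within the
approximation factor therefore leaves out `s` sets with a union of at most about
`n * L ^ (-(1 - δ) * (1 - q / p)) = o(n)` elements.  In a Random input, by a union bound, any `s`
sets cover a quarter of the `n` elements with probability `1 - o(1)`, so comparing the union of the
sets that are left out with `n / 4` tells the two kinds apart.  For `p = q` the factor is less than
`1`, which no algorithm can achieve on an instance of positive cost.
-/

/-! ### Trees as lists and truth values -/

namespace FairClustering

namespace Data

/-- The list represented by a tree; inverse to `ofList`. -/
def toList : Data → List Data
  | nil => []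
  | node a b => a :: b.toList

/-- The truth value of a tree in a test: every tree but `nil` counts as true. -/
def toBool : Data → Bool
  | nil => false
  | node _ _ => true

/-- The number of true entries of a list of truth values. -/
def trueCount (x : Data) : ℕ := x.toList.countP toBool

@[simp] theorem size_nil : nil.size = 1 := rfl

@[simp] theorem size_node (a b : Data) : (node a b).size = 1 + a.size + b.size := rfl

@[simp] theorem head_nil : nil.head = nil := rfl

@[simp] theorem head_node (a b : Data) : (node a b).head = a := rfl

@[simp] theorem tail_nil : nil.tail = nil := rfl

@[simp] theorem tail_node (a b : Data) : (node a b).tail = b := rfl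

@[simp] theorem toList_nil : nil.toList = [] := rfl

@[simp] theorem toList_node (a b : Data) : (node a b).toList = a :: b.toList := rfl

@[simp] theorem ofList_nil : ofList [] = nil := rfl

@[simp] theorem ofList_cons (a : Data) (l : List Data) : ofList (a :: l) = node a (ofList l) := rfl

@[simp] theorem toBool_nil : nil.toBool = false := rfl

@[simp] theorem toBool_node (a b : Data) : (node a b).toBool = true := rfl

@[simp] theorem toBool_ofBool (b : Bool) : (ofBool b).toBool = b := by cases b <;> rfl

theorem toBool_eq_true_iff {x : Data} : x.toBool = true ↔ x ≠ nil := by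
  cases x <;> simp only [toBool_nil, toBool_node, Bool.false_eq_true, ne_eq, not_true, reduceCtorEq,
    not_false_eq_true]

@[simp] theorem toList_ofList (l : List Data) : (ofList l).toList = l := by
  induction l with
  | nil => rfl
  | cons a l ih => simp [ih]

@[simp] theorem ofList_toList (x : Data) : ofList x.toList = x := by
  induction x with
  | nil => rfl
  | node a b _ ih => simp [ih]

@[simp] theorem toList_ofUnary (n : ℕ) : (ofUnary n).toList = List.replicate n nil :=
  toList_ofList _

theorem toList_eq_nil_iff {x : Data} : x.toList = [] ↔ x = nil := by
  cases x <;> simp only [toList_nil, toList_node, reduceCtorEq]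

theorem one_le_size (x : Data) : 1 ≤ x.size := by
  cases x <;> simp only [size_nil, size_node] <;> omega

theorem size_head_le (x : Data) : x.head.size ≤ x.size := by
  cases x <;> simp only [head_nil, head_node, size_nil, size_node] <;> omega

theorem size_tail_le (x : Data) : x.tail.size ≤ x.size := by
  cases x <;> simp only [tail_nil, tail_node, size_nil, size_node] <;> omega

theorem size_ofBool_le (b : Bool) : (ofBool b).size ≤ 3 := by cases b <;> simp [ofBool]

theorem size_ofList (l : List Data) : (ofList l).size = 1 + (l.map fun a => a.size + 1).sum := by
  induction l with
  | nil => rfl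
  | cons a l ih => simp only [ofList_cons, size_node, ih, List.map_cons, List.sum_cons]; omega

theorem size_ofUnary (n : ℕ) : (ofUnary n).size = 1 + 2 * n := by
  simp [ofUnary, size_ofList, mul_comm]

theorem length_toList_lt_size (x : Data) : x.toList.length < x.size := by
  induction x with
  | nil => simp
  | node a b _ ih => simp only [toList_node, List.length_cons, size_node]; omega

theorem size_lt_of_mem_toList {x a : Data} (ha : a ∈ x.toList) : a.size < x.size := by
  induction x with
  | nil => simp at ha
  | node b c _ ih =>
    rcases List.mem_cons.1 ha with rfl | ha
    · rw [size_node]; omega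
    · have := ih ha
      rw [size_node]; omega

end Data

/-! ### Polynomial bounds -/

theorem polynomialEval_mono (P : Polynomial ℕ) : Monotone fun n => P.eval n := fun a b hab => by
  simp only [Polynomial.eval_eq_sum_range]
  gcongr

/-- The quantity `φ` is bounded by a polynomial in the size of the input. -/
def PolyBounded (φ : Data → ℕ) : Prop := ∃ P : Polynomial ℕ, ∀ x, φ x ≤ P.eval x.size

namespace PolyBounded

variable {φ ψ : Data → ℕ}

theorem mono (hψ : PolyBounded ψ) (h : ∀ x, φ x ≤ ψ x) : PolyBounded φ :=
  hψ.imp fun _ hP x => (h x).trans (hP x)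

theorem const (n : ℕ) : PolyBounded fun _ => n := ⟨Polynomial.C n, by simp⟩

theorem size : PolyBounded Data.size := ⟨Polynomial.X, by simp⟩

theorem add (hφ : PolyBounded φ) (hψ : PolyBounded ψ) : PolyBounded fun x => φ x + ψ x := by
  obtain ⟨P, hP⟩ := hφ
  obtain ⟨Q, hQ⟩ := hψ
  exact ⟨P + Q, fun x => by simpa using add_le_add (hP x) (hQ x)⟩

theorem mul (hφ : PolyBounded φ) (hψ : PolyBounded ψ) : PolyBounded fun x => φ x * ψ x := by
  obtain ⟨P, hP⟩ := hφ
  obtain ⟨Q, hQ⟩ := hψ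
  exact ⟨P * Q, fun x => by simpa using Nat.mul_le_mul (hP x) (hQ x)⟩

theorem eval (P : Polynomial ℕ) (hφ : PolyBounded φ) : PolyBounded fun x => P.eval (φ x) := by
  obtain ⟨Q, hQ⟩ := hφ
  exact ⟨P.comp Q, fun x => by simpa using polynomialEval_mono P (hQ x)⟩

theorem comp (hφ : PolyBounded φ) {f : Data → Data} (hf : PolyBounded fun x => (f x).size) :
    PolyBounded fun x => φ (f x) := by
  obtain ⟨P, hP⟩ := hφ
  exact (hf.eval P).mono fun x => hP (f x)

end PolyBounded

/-! ### The variables of a program -/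

/-- A strict upper bound for the variables of an expression. -/
def Expr.bound : Expr → ℕ
  | .nil => 0
  | .var x => x + 1
  | .node a b => max a.bound b.bound
  | .head a => a.bound
  | .tail a => a.bound

/-- A strict upper bound for the variables of a program. -/
def Program.bound : Program → ℕ
  | .skip => 0
  | .assign x e => max (x + 1) e.bound
  | .toss x => x + 1
  | .seq a b => max a.bound b.bound
  | .branch e a b => max e.bound (max a.bound b.bound)
  | .loop e a => max e.bound a.bound

/-- The state after storing a tree in a variable. -/
def State.update (st : State) (x : ℕ) (b : Data) : State :=
  ⟨Function.update st.store x b, st.coins⟩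

theorem Expr.eval_update (e : Expr) {M : ℕ} (he : e.bound ≤ M) (σ : Store) (b : Data) :
    e.eval (Function.update σ M b) = e.eval σ := by
  induction e with
  | nil => rfl
  | var x => exact Function.update_of_ne (by simp only [Expr.bound] at he; omega) _ _
  | node _ _ ih₁ ih₂ =>
    simp only [Expr.bound, max_le_iff] at he
    simp only [Expr.eval, ih₁ he.1, ih₂ he.2]
  | head _ ih => exact congrArg Data.head (ih he)
  | tail _ ih => exact congrArg Data.tail (ih he)

namespace Run

variable {c : Program} {st st' : State} {t : ℕ}

theorem update (h : Run c st st' t) {M : ℕ} (hM : c.bound ≤ M) (b : Data) :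
    Run c (st.update M b) (st'.update M b) t := by
  induction h with simp only [Program.bound, max_le_iff] at hM
  | skip st => exact .skip _
  | assign x e st =>
    have h := Run.assign x e (st.update M b)
    rw [State.update, e.eval_update hM.2] at h
    simpa only [State.update, Function.update_comm (show M ≠ x by omega)] using h
  | toss x st =>
    convert Run.toss x (st.update M b) using 1
    simp only [State.update, Function.update_comm (show x ≠ M by omega)]
  | seq _ _ ih₁ ih₂ => exact (ih₁ hM.1).seq (ih₂ hM.2)
  | @branch_true e _ _ _ _ _ he _ ih =>
    exact .branch_true (by rwa [State.update, e.eval_update hM.1]) (ih hM.2.1)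
  | @branch_false e _ _ _ _ _ he _ ih =>
    exact .branch_false (by rwa [State.update, e.eval_update hM.1]) (ih hM.2.2)
  | @loop_true e _ _ _ _ _ _ he _ _ ih₁ ih₂ =>
    exact .loop_true (by rwa [State.update, e.eval_update hM.1]) (ih₁ hM.2)
      (ih₂ (by simpa only [Program.bound, max_le_iff]))
  | @loop_false e _ _ he => exact .loop_false (by rwa [State.update, e.eval_update hM.1])

theorem store_eq_of_bound_le (h : Run c st st' t) {i : ℕ} (hi : c.bound ≤ i) :
    st'.store i = st.store i := by
  induction h with simp only [Program.bound, max_le_iff] at hi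
  | skip => rfl
  | assign => exact Function.update_of_ne (by omega) _ _
  | toss => exact Function.update_of_ne (by omega) _ _
  | seq _ _ ih₁ ih₂ => rw [ih₂ hi.2, ih₁ hi.1]
  | branch_true _ _ ih => exact ih hi.2.1
  | branch_false _ _ ih => exact ih hi.2.2
  | loop_true _ _ _ ih₁ ih₂ =>
    rw [ih₂ (by simpa only [Program.bound, max_le_iff]), ih₁ hi.2]
  | loop_false => rfl

theorem size_store_le (h : Run c st st' t) {B : ℕ} (hB : ∀ i, (st.store i).size ≤ B) (i : ℕ) :
    (st'.store i).size ≤ B + 3 * t := by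
  induction h generalizing B i with
  | skip => exact (hB i).trans (Nat.le_add_right _ _)
  | assign x e st =>
    rcases eq_or_ne i x with rfl | hi
    · simp only [Function.update_self]; omega
    · simpa only [Function.update_of_ne hi] using (hB i).trans (Nat.le_add_right _ _)
  | toss x st =>
    rcases eq_or_ne i x with rfl | hi
    · have := Data.size_ofBool_le (st.coins 0)
      simp only [Function.update_self]; omega
    · simpa only [Function.update_of_ne hi] using (hB i).trans (Nat.le_add_right _ _)
  | seq _ _ ih₁ ih₂ => have := ih₂ (ih₁ hB) i; omega
  | branch_true _ _ ih => have := ih hB i; omega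
  | branch_false _ _ ih => have := ih hB i; omega
  | loop_true _ _ _ ih₁ ih₂ => have := ih₂ (ih₁ hB) i; omega
  | loop_false => exact (hB i).trans (Nat.le_add_right _ _)

theorem size_store_le_of_initState {x : Data} {ω : ℕ → Bool} (h : Run c (initState x ω) st t)
    (i : ℕ) : (st.store i).size ≤ x.size + 3 * t := by
  refine h.size_store_le (fun j => ?_) i
  rcases eq_or_ne j 0 with rfl | hj
  · simp [initState]
  · simpa [initState, hj] using x.one_le_size

end Run

/-! ### Subroutines -/

theorem mk_eq_initState {σ : Store} (hσ : ∀ i, 0 < i → σ i = Data.nil) (ω : ℕ → Bool) :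
    State.mk σ ω = initState (σ 0) ω := by
  refine congrArg (State.mk · ω) (funext fun i => ?_)
  rcases Nat.eq_zero_or_pos i with rfl | hi
  · rw [Function.update_self]
  · rw [hσ i hi, Function.update_of_ne hi.ne']

theorem run_assign_initState (e : Expr) (x : Data) (ω : ℕ → Bool) :
    Run (.assign 0 e) (initState x ω) (initState (e.eval (initState x ω).store) ω)
      (1 + (e.eval (initState x ω).store).size) := by
  simpa only [initState, Function.update_idem] using Run.assign 0 e (initState x ω)

/-- The program that resets the variables `1, …, M`. -/
def clear : ℕ → Program
  | 0 => .skip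
  | M + 1 => .seq (.assign (M + 1) .nil) (clear M)

theorem clear_deterministic (M : ℕ) : (clear M).Deterministic := by
  induction M with
  | zero => trivial
  | succ M ih => exact ⟨trivial, ih⟩

theorem run_clear (M : ℕ) {σ : Store} (hσ : ∀ i, M < i → σ i = Data.nil) (ω : ℕ → Bool) :
    Run (clear M) ⟨σ, ω⟩ (initState (σ 0) ω) (2 * M + 1) := by
  induction M generalizing σ with
  | zero => exact mk_eq_initState hσ ω ▸ .skip _
  | succ M ih =>
    have hassign := Run.assign (M + 1) .nil ⟨σ, ω⟩
    have hclear := ih (σ := Function.update σ (M + 1) Data.nil) fun i hi => by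
      rcases eq_or_ne i (M + 1) with rfl | hne
      · exact Function.update_self ..
      · rw [Function.update_of_ne hne, hσ i (by omega)]
    rw [Function.update_of_ne (Nat.succ_ne_zero M).symm] at hclear
    have htime : 1 + (Expr.nil.eval σ).size + (2 * M + 1) = 2 * (M + 1) + 1 := by
      simp only [Expr.eval, Data.size_nil]; omega
    exact htime ▸ hassign.seq hclear

/-- The program that replaces the head of the input by the output of `c` on it and keeps the tail;
the tail is saved in a variable which `c` does not touch. -/
def callOnHead (c : Program) : Program :=
  .seq (.assign (c.bound + 1) (.tail (.var 0))) <| .seq (.assign 0 (.head (.var 0))) <| .seq c <|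
    .seq (.assign 0 (.node (.var 0) (.var (c.bound + 1)))) (clear (c.bound + 1))

theorem callOnHead_deterministic {c : Program} (hc : c.Deterministic) :
    (callOnHead c).Deterministic :=
  ⟨trivial, trivial, hc, trivial, clear_deterministic _⟩

theorem run_callOnHead {c : Program} {x : Data} {ω : ℕ → Bool} {st : State} {t : ℕ}
    (h : Run c (initState x.head ω) st t) :
    ∃ t' ≤ 4 * t + 5 * x.size + 2 * c.bound + 8,
      Run (callOnHead c) (initState x ω)
        (initState (Data.node (st.store 0) x.tail) st.coins) t' := by
  set M := c.bound + 1
  have hM0 : (0 : ℕ) ≠ M := by omega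
  have hcall := h.update (M := M) (by omega) x.tail
  have hhead : Run (.assign 0 (.head (.var 0))) ((initState x ω).update M x.tail)
      ((initState x.head ω).update M x.tail) (1 + x.head.size) := by
    convert Run.assign 0 (.head (.var 0)) ((initState x ω).update M x.tail) using 1
    · simp [State.update, initState, Expr.eval, Function.update_comm hM0]
    · simp [State.update, initState, Expr.eval, hM0]
  have hpair := Run.assign 0 (.node (.var 0) (.var M)) (st.update M x.tail)
  have hclear := run_clear M (ω := st.coins)
    (σ := Function.update (st.update M x.tail).store 0 (Data.node (st.store 0) x.tail))
    fun i hi => by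
      have hi0 : i ≠ 0 := by omega
      simp only [State.update, Function.update_of_ne hi0, Function.update_of_ne hi.ne']
      rw [h.store_eq_of_bound_le (by omega)]
      simp only [initState, Function.update_of_ne hi0]
  have hvalue : Expr.eval (st.update M x.tail).store (.node (.var 0) (.var M)) =
      Data.node (st.store 0) x.tail := by
    simp [Expr.eval, State.update, hM0]
  rw [hvalue] at hpair
  rw [Function.update_self] at hclear
  refine ⟨_, ?_, (Run.assign M (.tail (.var 0)) (initState x ω)).seq
    (hhead.seq (hcall.seq (hpair.seq hclear)))⟩
  have hsize := h.size_store_le_of_initState 0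
  have := x.size_head_le
  have := x.size_tail_le
  simp only [Expr.eval, initState, Function.update_self, Data.size_node]
  omega

/-! ### Functions computable in polynomial time -/

/-- The deterministic program `c` computes `f` in time `T`; it leaves only the output behind, so
that programs can be composed without further ado. -/
def Computes (c : Program) (f : Data → Data) (T : Data → ℕ) : Prop :=
  c.Deterministic ∧ ∀ x ω, ∃ t ≤ T x, Run c (initState x ω) (initState (f x) ω) t

/-- Functions on trees that are computable in polynomial time. -/
def PolyComputable (f : Data → Data) : Prop :=
  ∃ (c : Program) (T : Data → ℕ), PolyBounded T ∧ Computes c f T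

/-- Predicates on trees that are decidable in polynomial time. -/
def PolyDecidable (p : Data → Prop) : Prop :=
  ∃ b : Data → Data, PolyComputable b ∧ ∀ x, (b x).toBool = true ↔ p x

theorem Expr.polyBounded_size_eval (e : Expr) (ω : ℕ → Bool) :
    PolyBounded fun x => (e.eval (initState x ω).store).size := by
  induction e with
  | nil => exact .const 1
  | var i =>
    refine .mono .size fun x => ?_
    rcases eq_or_ne i 0 with rfl | hi
    · simp [Expr.eval, initState]
    · simpa [Expr.eval, initState, hi] using x.one_le_size
  | node _ _ ih₁ ih₂ => exact ((PolyBounded.const 1).add ih₁).add ih₂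
  | head _ ih => exact ih.mono fun x => Data.size_head_le _
  | tail _ ih => exact ih.mono fun x => Data.size_tail_le _

namespace PolyComputable

open Data

variable {f g : Data → Data}

theorem polyBounded_size (hf : PolyComputable f) : PolyBounded fun x => (f x).size := by
  obtain ⟨c, T, hT, -, hrun⟩ := hf
  refine (PolyBounded.size.add ((PolyBounded.const 3).mul hT)).mono fun x => ?_
  obtain ⟨t, ht, hrun⟩ := hrun x fun _ => false
  have hsize := hrun.size_store_le_of_initState 0
  simp only [initState, Function.update_self] at hsize
  omega

theorem of_expr (e : Expr) (he : ∀ σ : Store, e.eval σ = f (σ 0)) : PolyComputable f := by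
  have hf : ∀ x ω, e.eval (initState x ω).store = f x := fun x ω => he _
  refine ⟨.assign 0 e, fun x => 1 + (f x).size, ?_, trivial, fun x ω => ⟨_, le_rfl, ?_⟩⟩
  · simpa only [hf] using (PolyBounded.const 1).add (e.polyBounded_size_eval fun _ => false)
  · simpa only [hf] using run_assign_initState e x ω

theorem of_eq (hf : PolyComputable f) (h : ∀ x, f x = g x) : PolyComputable g := funext h ▸ hf

protected theorem id : PolyComputable fun x => x := of_expr (.var 0) fun _ => rfl

theorem comp (hf : PolyComputable f) (hg : PolyComputable g) :
    PolyComputable fun x => f (g x) := by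
  have hsize := hg.polyBounded_size
  obtain ⟨c, T, hT, hc, hrun⟩ := hf
  obtain ⟨c', T', hT', hc', hrun'⟩ := hg
  refine ⟨.seq c' c, fun x => T' x + T (g x), hT'.add (hT.comp hsize), ⟨hc', hc⟩, fun x ω => ?_⟩
  obtain ⟨t', ht', h'⟩ := hrun' x ω
  obtain ⟨t, ht, h⟩ := hrun (g x) ω
  exact ⟨t' + t, add_le_add ht' ht, h'.seq h⟩

theorem head (hf : PolyComputable f) : PolyComputable fun x => (f x).head :=
  comp (of_expr (.head (.var 0)) fun _ => rfl) hf

theorem tail (hf : PolyComputable f) : PolyComputable fun x => (f x).tail :=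
  comp (of_expr (.tail (.var 0)) fun _ => rfl) hf

theorem map_head (hf : PolyComputable f) : PolyComputable fun x => Data.node (f x.head) x.tail := by
  obtain ⟨c, T, hT, hc, hrun⟩ := hf
  refine ⟨callOnHead c, fun x => 4 * T x.head + 5 * x.size + 2 * c.bound + 8, ?_,
    callOnHead_deterministic hc, fun x ω => ?_⟩
  · exact ((((PolyBounded.const 4).mul (hT.comp (PolyBounded.size.mono size_head_le))).add
      ((PolyBounded.const 5).mul .size)).add (.const _)).add (.const _)
  · obtain ⟨t, ht, h⟩ := hrun x.head ω
    obtain ⟨t', ht', h'⟩ := run_callOnHead h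
    refine ⟨t', ht'.trans ?_, h'⟩
    dsimp only
    omega

theorem node (hf : PolyComputable f) (hg : PolyComputable g) :
    PolyComputable fun x => Data.node (f x) (g x) := by
  have hswap : PolyComputable fun x => Data.node x.tail x.head :=
    of_expr (.node (.tail (.var 0)) (.head (.var 0))) fun _ => rfl
  have hdup : PolyComputable fun x => Data.node x x :=
    of_expr (.node (.var 0) (.var 0)) fun _ => rfl
  exact hswap.comp (hg.map_head.comp (hswap.comp (hf.map_head.comp hdup)))

theorem const (a : Data) : PolyComputable fun _ => a := by
  induction a with
  | nil => exact of_expr .nil fun _ => rfl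
  | node a b iha ihb => exact iha.node ihb

theorem ite {p : Data → Prop} [DecidablePred p] (hp : PolyDecidable p) (hf : PolyComputable f)
    (hg : PolyComputable g) : PolyComputable fun x => if p x then f x else g x := by
  obtain ⟨b, hb, hbp⟩ := hp
  obtain ⟨c, T, hT, hc, hrun⟩ := comp hf PolyComputable.id.tail
  obtain ⟨c', T', hT', hc', hrun'⟩ := comp hg PolyComputable.id.tail
  have hbranch : PolyComputable fun x => bif x.head.toBool then f x.tail else g x.tail := by
    refine ⟨.branch (.head (.var 0)) c c', fun x => 1 + (T x + T' x),
      (PolyBounded.const 1).add (hT.add hT'), ⟨hc, hc'⟩, fun x ω => ?_⟩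
    by_cases hx : x.head = Data.nil
    · obtain ⟨t, ht, h⟩ := hrun' x ω
      refine ⟨1 + t, Nat.add_le_add_left (ht.trans (Nat.le_add_left _ _)) 1, ?_⟩
      simpa only [hx, toBool_nil, cond_false] using
        Run.branch_false (e := .head (.var 0)) (st := initState x ω) hx h
    · obtain ⟨t, ht, h⟩ := hrun x ω
      refine ⟨1 + t, Nat.add_le_add_left (ht.trans (Nat.le_add_right _ _)) 1, ?_⟩
      simpa only [toBool_eq_true_iff.2 hx, cond_true] using
        Run.branch_true (e := .head (.var 0)) (st := initState x ω) hx h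
  refine (hbranch.comp (hb.node .id)).of_eq fun x => ?_
  simp only [head_node, tail_node, Bool.cond_eq_ite, hbp]

theorem _root_.FairClustering.Computes.exists_run_loop {c : Program} {T : Data → ℕ}
    (hc : Computes c f T) (ω : ℕ → Bool) (n : ℕ) {x : Data}
    (hlt : ∀ i < n, (f^[i] x).head ≠ Data.nil) (hn : (f^[n] x).head = Data.nil) :
    ∃ t ≤ 1 + ∑ i ∈ Finset.range n, (1 + T (f^[i] x)),
      Run (.loop (.head (.var 0)) c) (initState x ω) (initState (f^[n] x) ω) t := by
  induction n generalizing x with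
  | zero => exact ⟨1, by simp, .loop_false hn⟩
  | succ n ih =>
    obtain ⟨t, ht, hbody⟩ := hc.2 x ω
    obtain ⟨t', ht', hrest⟩ := ih (x := f x) (fun i hi => hlt (i + 1) (by omega)) hn
    refine ⟨1 + t + t', ?_, .loop_true (hlt 0 n.succ_pos) hbody hrest⟩
    rw [Finset.sum_range_succ']
    simp only [Function.iterate_succ_apply, Function.iterate_zero_apply]
    omega

theorem iterate {s : Data → Data} {n B : Data → ℕ} (hf : PolyComputable f) (hs : PolyComputable s)
    (hn : PolyBounded n) (hB : PolyBounded B) (hsize : ∀ x, ∀ i < n x, (f^[i] (s x)).size ≤ B x)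
    (hlt : ∀ x, ∀ i < n x, (f^[i] (s x)).head ≠ Data.nil)
    (hend : ∀ x, (f^[n x] (s x)).head = Data.nil) : PolyComputable fun x => f^[n x] (s x) := by
  obtain ⟨c, T, ⟨P, hP⟩, hcomp⟩ := hf
  obtain ⟨c', T', hT', hc', hrun'⟩ := hs
  refine ⟨.seq c' (.loop (.head (.var 0)) c), fun x => T' x + (1 + n x * (1 + P.eval (B x))),
    hT'.add ((PolyBounded.const 1).add (hn.mul ((PolyBounded.const 1).add (hB.eval P)))),
    ⟨hc', hcomp.1⟩, fun x ω => ?_⟩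
  obtain ⟨t', ht', h'⟩ := hrun' x ω
  obtain ⟨t, ht, h⟩ := hcomp.exists_run_loop ω (n x) (hlt x) (hend x)
  refine ⟨t' + t, add_le_add ht' (ht.trans (Nat.add_le_add_left ?_ 1)), h'.seq h⟩
  have hstep : ∀ i ∈ Finset.range (n x), 1 + T (f^[i] (s x)) ≤ 1 + P.eval (B x) := fun i hi =>
    Nat.add_le_add_left
      ((hP _).trans (polynomialEval_mono P (hsize x i (Finset.mem_range.1 hi)))) 1
  simpa using Finset.sum_le_card_nsmul _ _ _ hstep

/-! ### Lists -/

/-- One round of a fold with step `g x`: the state consists of the elements still to be read, the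
parameter `x` and the accumulator. -/
def foldStep (g : Data → Data → Data → Data) (z : Data) : Data :=
  .node z.head.tail (.node z.tail.head (g z.tail.head z.tail.tail z.head.head))

theorem foldStep_iterate (g : Data → Data → Data → Data) (x a : Data) (L : List Data) {i : ℕ}
    (hi : i ≤ L.length) :
    (foldStep g)^[i] (.node (ofList L) (.node x a)) =
      .node (ofList (L.drop i)) (.node x ((L.take i).foldl (g x) a)) := by
  induction i generalizing L a with
  | zero => rfl
  | succ i ih =>
    obtain _ | ⟨b, L⟩ := L
    · simp at hi
    · exact ih (g x a b) L (Nat.le_of_succ_le_succ hi)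

theorem foldl_of_prefix_size_le {l s : Data → Data} {g : Data → Data → Data → Data} {B : Data → ℕ}
    (hg : PolyComputable fun z => g z.head z.tail.head z.tail.tail) (hl : PolyComputable l)
    (hs : PolyComputable s) (hB : PolyBounded B)
    (hsize : ∀ x, ∀ L, L <+: (l x).toList → (L.foldl (g x) (s x)).size ≤ B x) :
    PolyComputable fun x => (l x).toList.foldl (g x) (s x) := by
  have hstep : PolyComputable (foldStep g) :=
    PolyComputable.id.head.tail.node (PolyComputable.id.tail.head.node
      (hg.comp (PolyComputable.id.tail.head.node
        (PolyComputable.id.tail.tail.node PolyComputable.id.head.head))))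
  have hiter : ∀ x, ∀ i ≤ (l x).toList.length,
      (foldStep g)^[i] (.node (l x) (.node x (s x))) =
        .node (ofList ((l x).toList.drop i))
          (.node x (((l x).toList.take i).foldl (g x) (s x))) := fun x i hi => by
    simpa only [ofList_toList] using foldStep_iterate g x (s x) (l x).toList hi
  have hfold := hstep.iterate (hl.node (PolyComputable.id.node hs))
    (n := fun x => (l x).toList.length) (B := fun x => 2 + (l x).size + x.size + B x)
    (hl.polyBounded_size.mono fun x => (length_toList_lt_size _).le)
    ((((PolyBounded.const 2).add hl.polyBounded_size).add .size).add hB) (fun x i hi => ?_)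
    (fun x i hi => ?_) (fun x => by rw [hiter x _ le_rfl]; simp)
  · refine hfold.tail.tail.of_eq fun x => ?_
    rw [hiter x _ le_rfl, List.take_length]
    rfl
  · have hacc := hsize x _ (List.take_prefix i _)
    have hrest : (ofList ((l x).toList.drop i)).size ≤ (l x).size := by
      nth_rewrite 2 [← ofList_toList (l x)]
      simp only [size_ofList, List.map_drop]
      exact Nat.add_le_add_left ((List.drop_sublist i _).sum_le_sum fun _ _ => Nat.zero_le _) 1
    simp only [hiter x i hi.le, size_node]
    omega
  · rw [hiter x i hi.le, List.drop_eq_getElem_cons hi]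
    simp only [head_node, ofList_cons, ne_eq, reduceCtorEq, not_false_eq_true]

theorem foldl {l s : Data → Data} {g : Data → Data → Data → Data} {b : Data → ℕ}
    (hg : PolyComputable fun z => g z.head z.tail.head z.tail.tail) (hl : PolyComputable l)
    (hs : PolyComputable s) (hb : PolyBounded b)
    (hsize : ∀ x, ∀ a ∈ (l x).toList, ∀ y, (g x y a).size ≤ y.size + b x) :
    PolyComputable fun x => (l x).toList.foldl (g x) (s x) := by
  have hgrow : ∀ x (L : List Data), (∀ a ∈ L, a ∈ (l x).toList) → ∀ y,
      (L.foldl (g x) y).size ≤ y.size + L.length * b x := fun x L => by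
    induction L with
    | nil => simp
    | cons a L ih =>
      intro hL y
      have hstep := hsize x a (hL a List.mem_cons_self) y
      have htail := ih (fun a' ha' => hL a' (List.mem_cons_of_mem a ha')) (g x y a)
      rw [List.foldl_cons, List.length_cons, Nat.add_mul, Nat.one_mul]
      omega
  refine foldl_of_prefix_size_le hg hl hs
    (hs.polyBounded_size.add (hl.polyBounded_size.mul hb)) fun x L hL => ?_
  refine (hgrow x L (fun a ha => hL.subset ha) (s x)).trans ?_
  gcongr
  exact hL.length_le.trans (length_toList_lt_size _).le

section Lists

variable {h : Data → Data → Data} {l : Data → Data}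

theorem reverse (hl : PolyComputable l) : PolyComputable fun x => ofList (l x).toList.reverse := by
  have hcons : PolyComputable fun z => Data.node z.tail.tail z.tail.head :=
    PolyComputable.id.tail.tail.node PolyComputable.id.tail.head
  refine (foldl (g := fun _ y a => .node a y) hcons hl (const .nil)
    ((PolyBounded.const 1).add hl.polyBounded_size) fun x a ha y => ?_).of_eq fun x => ?_
  · have := size_lt_of_mem_toList ha
    rw [size_node]; omega
  · have hrev : ∀ (L : List Data) (y : Data),
        L.foldl (fun y a => .node a y) y = ofList (L.reverse ++ y.toList) := fun L => by
      induction L with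
      | nil => simp
      | cons a L ih => intro y; simp [ih]
    simp [hrev]

theorem foldr {s : Data → Data} {g : Data → Data → Data → Data} {b : Data → ℕ}
    (hg : PolyComputable fun z => g z.head z.tail.head z.tail.tail) (hl : PolyComputable l)
    (hs : PolyComputable s) (hb : PolyBounded b)
    (hsize : ∀ x, ∀ a ∈ (l x).toList, ∀ y, (g x a y).size ≤ y.size + b x) :
    PolyComputable fun x => (l x).toList.foldr (g x) (s x) := by
  have hg' : PolyComputable fun z => g z.head z.tail.tail z.tail.head :=
    hg.comp (PolyComputable.id.head.node
      (PolyComputable.id.tail.tail.node PolyComputable.id.tail.head))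
  refine (foldl (g := fun x y a => g x a y) hg' hl.reverse hs hb fun x a ha y =>
    hsize x a (by simpa using ha) y).of_eq fun x => ?_
  simp [List.foldl_reverse]

theorem append (hf : PolyComputable f) (hg : PolyComputable g) :
    PolyComputable fun x => ofList ((f x).toList ++ (g x).toList) := by
  refine (foldr (g := fun _ => .node)
    (PolyComputable.id.tail.head.node PolyComputable.id.tail.tail) hf hg
    ((PolyBounded.const 1).add hf.polyBounded_size) fun x a ha y => ?_).of_eq fun x => ?_
  · have := size_lt_of_mem_toList ha
    rw [size_node]; omega
  · induction (f x).toList with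
    | nil => simp
    | cons a L ih => simp [ih]

theorem _root_.FairClustering.PolyBounded.exists_bound_of_mem {φ : Data → ℕ} (hφ : PolyBounded φ)
    (hl : PolyBounded fun x => (l x).size) :
    ∃ ψ, PolyBounded ψ ∧ ∀ x, ∀ a ∈ (l x).toList, φ (.node x a) ≤ ψ x := by
  obtain ⟨P, hP⟩ := hφ
  refine ⟨fun x => P.eval (1 + x.size + (l x).size),
    (((PolyBounded.const 1).add .size).add hl).eval P, fun x a ha => (hP _).trans ?_⟩
  have := size_lt_of_mem_toList ha
  exact polynomialEval_mono P (by rw [size_node]; omega)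

theorem flatMap (hh : PolyComputable fun z => h z.head z.tail) (hl : PolyComputable l) :
    PolyComputable fun x => ofList ((l x).toList.flatMap fun a => (h x a).toList) := by
  obtain ⟨b, hb, hsize⟩ := hh.polyBounded_size.exists_bound_of_mem hl.polyBounded_size
  refine (foldr (g := fun x a y => ofList ((h x a).toList ++ y.toList)) (append
    (hh.comp (PolyComputable.id.head.node PolyComputable.id.tail.head)) PolyComputable.id.tail.tail)
    hl (const .nil) hb fun x a ha y => ?_).of_eq fun x => ?_
  · have hsum : (ofList ((h x a).toList ++ y.toList)).size + 1 = (h x a).size + y.size := by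
      nth_rewrite 2 [← ofList_toList (h x a), ← ofList_toList y]
      simp only [size_ofList, List.map_append, List.sum_append]
      omega
    have hbound : (h x a).size ≤ b x := hsize x a ha
    omega
  · induction (l x).toList with
    | nil => rfl
    | cons a L ih => rw [List.foldr_cons, ih, toList_ofList, List.flatMap_cons]

theorem map (hh : PolyComputable fun z => h z.head z.tail) (hl : PolyComputable l) :
    PolyComputable fun x => ofList ((l x).toList.map (h x)) :=
  (flatMap (h := fun x a => .node (h x a) .nil) (hh.node (const .nil)) hl).of_eq fun x => by
    simp only [toList_node, toList_nil, List.map_eq_flatMap]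

theorem filter {p : Data → Data → Prop} [∀ x a, Decidable (p x a)]
    (hp : PolyDecidable fun z => p z.head z.tail) (hl : PolyComputable l) :
    PolyComputable fun x => ofList ((l x).toList.filter fun a => p x a) := by
  refine (flatMap (h := fun x a => if p x a then .node a .nil else .nil)
    (ite hp (PolyComputable.id.tail.node (const .nil)) (const .nil)) hl).of_eq fun x => ?_
  induction (l x).toList with
  | nil => rfl
  | cons a L ih =>
    rw [List.flatMap_cons, ← toList_ofList (L.flatMap _), ih, List.filter_cons]
    by_cases ha : p x a <;> simp [ha]

theorem zip (hf : PolyComputable f) (hg : PolyComputable g) :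
    PolyComputable fun x => ofList (List.zipWith .node (f x).toList (g x).toList) := by
  let step (y a : Data) : Data :=
    if y.head.toBool then .node y.head.tail (.node (.node a y.head.head) y.tail) else y
  have hstep : PolyComputable fun z => step z.tail.head z.tail.tail :=
    ite ⟨_, PolyComputable.id.tail.head.head, fun _ => Iff.rfl⟩
      (PolyComputable.id.tail.head.head.tail.node
        ((PolyComputable.id.tail.tail.node PolyComputable.id.tail.head.head.head).node
          PolyComputable.id.tail.head.tail)) PolyComputable.id.tail.head
  have hfold : ∀ (L : List Data) (b y : Data), (L.foldl step (.node b y)).tail =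
      ofList ((List.zipWith .node L b.toList).reverse ++ y.toList) := fun L => by
    induction L with
    | nil => simp
    | cons a L ih =>
      intro b y
      cases b with
      | nil => simpa [step] using ih .nil y
      | node b₁ b₂ => simp [step, ih]
  refine (foldl (g := fun _ => step) hstep hf (hg.node (const .nil))
    ((PolyBounded.const 1).add hf.polyBounded_size) fun x a ha y => ?_).tail.reverse.of_eq
      fun x => by simp [hfold]
  have := size_lt_of_mem_toList ha
  rcases y with _ | ⟨_ | ⟨b₁, b₂⟩, y⟩ <;> simp [step]
  omega

theorem zipWith (hh : PolyComputable fun z => h z.head z.tail) (hf : PolyComputable f)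
    (hg : PolyComputable g) :
    PolyComputable fun x => ofList (List.zipWith h (f x).toList (g x).toList) := by
  refine (map (h := fun _ z => h z.head z.tail) (hh.comp PolyComputable.id.tail)
    (zip hf hg)).of_eq fun x => ?_
  simp only [toList_ofList, List.map_zipWith, head_node, tail_node]

end Lists

end PolyComputable

/-! ### Decidable predicates -/

namespace PolyDecidable

open Data

variable {p r : Data → Prop}

theorem of_toBool {b : Data → Data} (hb : PolyComputable b) :
    PolyDecidable fun x => (b x).toBool = true := ⟨b, hb, fun _ => Iff.rfl⟩

theorem of_iff (hp : PolyDecidable p) (h : ∀ x, p x ↔ r x) : PolyDecidable r :=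
  (funext fun x => propext (h x)) ▸ hp

theorem polyComputable_ofBool [DecidablePred p] (hp : PolyDecidable p) :
    PolyComputable fun x => ofBool (decide (p x)) :=
  (PolyComputable.ite hp (.const (ofBool true)) (.const (ofBool false))).of_eq fun x => by
    by_cases hx : p x <;> simp [hx]

protected theorem not (hp : PolyDecidable p) : PolyDecidable fun x => ¬ p x := by
  classical
  exact (of_toBool (PolyComputable.ite hp (.const .nil) (.const (.node .nil .nil)))).of_iff
    fun x => by by_cases hx : p x <;> simp [hx]

protected theorem and (hp : PolyDecidable p) (hr : PolyDecidable r) :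
    PolyDecidable fun x => p x ∧ r x := by
  classical
  exact (of_toBool (PolyComputable.ite hp hr.polyComputable_ofBool (.const .nil))).of_iff
    fun x => by by_cases hx : p x <;> simp [hx]

protected theorem or (hp : PolyDecidable p) (hr : PolyDecidable r) :
    PolyDecidable fun x => p x ∨ r x :=
  (hp.not.and hr.not).not.of_iff fun x => by tauto

theorem exists_mem {l : Data → Data} {p : Data → Data → Prop}
    (hp : PolyDecidable fun z => p z.head z.tail) (hl : PolyComputable l) :
    PolyDecidable fun x => ∃ a ∈ (l x).toList, p x a := by
  classical
  refine (of_toBool (PolyComputable.filter hp hl)).of_iff fun x => ?_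
  rw [toBool_eq_true_iff, ne_eq, ← toList_eq_nil_iff, toList_ofList, List.filter_eq_nil_iff]
  simp

end PolyDecidable

/-! ### Unary arithmetic -/

/-- Numerical functions that are computable in polynomial time with values in unary. -/
def UnaryComputable (φ : Data → ℕ) : Prop := PolyComputable fun x => Data.ofUnary (φ x)

namespace UnaryComputable

open Data

variable {φ ψ : Data → ℕ}

theorem const (n : ℕ) : UnaryComputable fun _ => n := PolyComputable.const _

theorem length {l : Data → Data} (hl : PolyComputable l) :
    UnaryComputable fun x => (l x).toList.length :=
  (PolyComputable.map (h := fun _ _ => .nil) (.const .nil) hl).of_eq fun x => by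
    rw [List.map_const', ofUnary]

theorem trueCount {l : Data → Data} (hl : PolyComputable l) :
    UnaryComputable fun x => (l x).trueCount := by
  refine (length (PolyComputable.filter (p := fun _ a => a.toBool = true)
    (.of_toBool PolyComputable.id.tail) hl)).of_eq fun x => ?_
  simp [Data.trueCount, List.countP_eq_length_filter]

theorem succ (hφ : UnaryComputable φ) : UnaryComputable fun x => φ x + 1 :=
  PolyComputable.node (.const .nil) hφ

theorem mul (hφ : UnaryComputable φ) (hψ : UnaryComputable ψ) :
    UnaryComputable fun x => φ x * ψ x := by
  refine (PolyComputable.flatMap (h := fun x _ => ofUnary (ψ x))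
    (hψ.comp PolyComputable.id.head) hφ).of_eq fun x => ?_
  rw [toList_ofUnary, toList_ofUnary, List.flatMap_replicate, List.flatten_replicate_replicate,
    ofUnary]

theorem sub (hφ : UnaryComputable φ) (hψ : UnaryComputable ψ) :
    UnaryComputable fun x => φ x - ψ x := by
  refine (PolyComputable.foldl (g := fun _ y _ => y.tail) PolyComputable.id.tail.head.tail hψ hφ
    (.const 0) fun x a _ y => y.size_tail_le).of_eq fun x => ?_
  simp only [toList_ofUnary]
  generalize φ x = n
  induction ψ x generalizing n with
  | zero => rfl
  | succ k ih =>
    have htail : (ofUnary n).tail = ofUnary (n - 1) := by cases n <;> rfl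
    rw [List.replicate_succ, List.foldl_cons, htail, ih, Nat.sub_sub, Nat.add_comm 1 k]

theorem lt (hφ : UnaryComputable φ) (hψ : UnaryComputable ψ) :
    PolyDecidable fun x => φ x < ψ x :=
  (PolyDecidable.of_toBool (hψ.sub hφ)).of_iff fun x => by
    rw [toBool_eq_true_iff, ne_eq, ← toList_eq_nil_iff, toList_ofUnary, List.replicate_eq_nil_iff,
      Nat.sub_eq_zero_iff_le, not_le]

theorem le (hφ : UnaryComputable φ) (hψ : UnaryComputable ψ) :
    PolyDecidable fun x => φ x ≤ ψ x :=
  (hψ.lt hφ).not.of_iff fun _ => not_lt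

theorem eq (hφ : UnaryComputable φ) (hψ : UnaryComputable ψ) :
    PolyDecidable fun x => φ x = ψ x :=
  ((hφ.le hψ).and (hψ.le hφ)).of_iff fun _ => le_antisymm_iff.symm

theorem range (hφ : UnaryComputable φ) :
    PolyComputable fun x => ofList ((List.range (φ x)).map ofUnary) := by
  let push (y : Data) : Data := ofList (y.toList ++ [ofUnary y.toList.length])
  have hpush : PolyComputable fun z => push z.tail.head :=
    PolyComputable.append PolyComputable.id.tail.head
      ((length PolyComputable.id.tail.head).node (.const .nil))
  have hfold : ∀ L : List Data, L.foldl (fun y _ => push y) .nil =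
      ofList ((List.range L.length).map ofUnary) := fun L => by
    induction L using List.reverseRecOn with
    | nil => rfl
    | append_singleton L a ih =>
      rw [List.foldl_append, ih, List.length_append]
      simp [push, List.range_succ]
  refine (PolyComputable.foldl_of_prefix_size_le (g := fun _ y _ => push y) hpush hφ (.const .nil)
    ((PolyBounded.const 1).add (hφ.polyBounded_size.mul ((PolyBounded.const 2).add
      hφ.polyBounded_size))) fun x L hL => ?_).of_eq fun x => by
        rw [hfold, toList_ofUnary, List.length_replicate]
  have hlen : L.length ≤ φ x := by simpa using hL.length_le
  rw [hfold, size_ofList, List.map_map]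
  refine Nat.add_le_add_left ((List.sum_le_card_nsmul _ (2 + (ofUnary (φ x)).size) ?_).trans ?_) 1
  · simp only [List.mem_map, List.mem_range, Function.comp_apply, size_ofUnary]
    rintro _ ⟨i, hi, rfl⟩
    omega
  · rw [List.length_map, List.length_range, smul_eq_mul]
    gcongr
    rw [size_ofUnary]
    omega

end UnaryComputable

/-! ### Reductions -/

theorem PolyTimeOn.exists_reduction {c : Program} {X Y : Set Data} (hc : PolyTimeOn c Y)
    {pre post : Data → Data} (hpre : PolyComputable pre) (hpost : PolyComputable post)
    (hXY : Set.MapsTo pre X Y) :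
    ∃ d : Program, (c.Deterministic → d.Deterministic) ∧ PolyTimeOn d X ∧
      ∀ x ω y, Outputs c (pre x) ω y → Outputs d x ω (post (.node y x)) := by
  obtain ⟨P, hP⟩ := hc
  obtain ⟨c₁, T₁, hT₁, hc₁, hrun₁⟩ := hpre.node .id
  obtain ⟨c₂, T₂, ⟨Q, hQ⟩, hc₂, hrun₂⟩ := hpost
  have hrun : ∀ x ω y t, HaltsWith c (pre x) ω y t → ∃ t' ≤ T₁ x +
      (4 * t + 5 * (Data.node (pre x) x).size + 2 * c.bound + 8 +
        Q.eval (1 + ((pre x).size + 3 * t) + x.size)),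
      HaltsWith (.seq c₁ (.seq (callOnHead c) c₂)) x ω (post (.node y x)) t' := by
    rintro x ω _ t ⟨st, hst, rfl⟩
    obtain ⟨t₁, ht₁, h₁⟩ := hrun₁ x ω
    obtain ⟨t', ht', h'⟩ := run_callOnHead (x := .node (pre x) x) hst
    obtain ⟨t₂, ht₂, h₂⟩ := hrun₂ (.node (st.store 0) x) st.coins
    have hsize : (Data.node (st.store 0) x).size ≤ 1 + ((pre x).size + 3 * t) + x.size := by
      have := hst.size_store_le_of_initState 0
      rw [Data.size_node]; omega
    exact ⟨t₁ + (t' + t₂), add_le_add ht₁ (add_le_add ht'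
      (ht₂.trans ((hQ _).trans (polynomialEval_mono Q hsize)))), _, h₁.seq (h'.seq h₂),
        by simp only [initState, Function.update_self]⟩
  refine ⟨.seq c₁ (.seq (callOnHead c) c₂), fun hdet => ⟨hc₁, callOnHead_deterministic hdet, hc₂⟩,
    ?_, fun x ω y ⟨t, hy⟩ => (hrun x ω y t hy).imp fun _ => And.right⟩
  have hsize := hpre.polyBounded_size
  have ht := hsize.eval P
  obtain ⟨R, hR⟩ := hT₁.add (((((PolyBounded.const 4).mul ht).add ((PolyBounded.const 5).mul
    (hpre.node .id).polyBounded_size)).add (.const (2 * c.bound))).add (.const 8) |>.add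
      ((((PolyBounded.const 1).add (hsize.add ((PolyBounded.const 3).mul ht))).add .size).eval Q))
  refine ⟨R, fun x hx ω => ?_⟩
  obtain ⟨y, t, hy, hyt⟩ := hP _ (hXY hx) ω
  obtain ⟨t', ht', hd⟩ := hrun x ω y t hy
  refine ⟨_, t', hd, ht'.trans (le_trans ?_ (hR x))⟩
  dsimp only [id_eq]
  gcongr
  exact polynomialEval_mono Q (by gcongr)

/-! ### From Min `s`-Union to fair clustering -/

/-- The clustering instance of `m` sets and the parameter `s`: the points are the sets, with the
uniform metric, the groups are the elements, and the points outside the centers are the selected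
sets.  For `s < m` the number of centers is `m - s`; it is written such that it is always
positive. -/
abbrev clusteringInstance {m n : ℕ} (S : Fin m → Finset (Fin n)) (s : ℕ) (hm : 1 ≤ m) :
    Instance where
  m := m
  n := n
  k := m - (s + 1) + 1
  d i j := if i = j then 0 else 1
  w i j := if i ∈ S j then 1 else 0
  d_eq_zero i j := by simp
  d_comm i j := by simp only [eq_comm]
  d_triangle i j l := by
    rcases eq_or_ne i j with rfl | hij
    · simp
    · rw [if_neg hij]
      exact le_add_right (by split_ifs <;> simp)
  one_le_k := Nat.le_add_left 1 _
  k_le_m := by omega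

section Encoding

open Data

/-- The code of `k`, of the uniform metric on `m` points and of the weights, computed from the code
of an input of Min `s`-Union. -/
def toClustering (x : Data) : Data :=
  .node (ofUnary (x.tail.toList.length - (x.head.toList.length + 1) + 1)) <|
    .node (ofList ((List.range x.tail.toList.length).map fun i =>
        ofList ((List.range x.tail.toList.length).map fun j =>
          if i = j then ofNNRat 0 else ofNNRat 1)))
      (ofList (x.tail.toList.map fun T =>
        ofList (T.toList.map fun b => if b.toBool then ofNNRat 1 else ofNNRat 0)))

theorem polyComputable_uniformMetric {φ : Data → ℕ} (hφ : UnaryComputable φ) (a b : Data) :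
    PolyComputable fun x => ofList ((List.range (φ x)).map fun i =>
      ofList ((List.range (φ x)).map fun j => if i = j then a else b)) := by
  have hentry : PolyComputable fun z =>
      if z.head.tail.toList.length = z.tail.toList.length then a else b :=
    .ite ((UnaryComputable.length PolyComputable.id.head.tail).eq (.length PolyComputable.id.tail))
      (.const a) (.const b)
  have hrow := PolyComputable.map
    (h := fun z c => if z.tail.toList.length = c.toList.length then a else b) hentry
    (hφ.range.comp PolyComputable.id.head)
  refine (PolyComputable.map (h := fun x c => ofList ((ofList ((List.range (φ x)).map
    ofUnary)).toList.map fun c' => if c.toList.length = c'.toList.length then a else b))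
    hrow hφ.range).of_eq fun x => ?_
  simp only [toList_ofList, List.map_map, Function.comp_def, toList_ofUnary, List.length_replicate]

theorem polyComputable_toClustering : PolyComputable toClustering := by
  have hm : UnaryComputable fun x => x.tail.toList.length := .length PolyComputable.id.tail
  have hweight : PolyComputable fun z => if z.tail.toBool then ofNNRat 1 else ofNNRat 0 :=
    .ite (.of_toBool PolyComputable.id.tail) (.const _) (.const _)
  have hweights : PolyComputable fun z => ofList (z.tail.toList.map fun b =>
      if b.toBool then ofNNRat 1 else ofNNRat 0) :=
    .map (h := fun _ b => if b.toBool then ofNNRat 1 else ofNNRat 0) hweight PolyComputable.id.tail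
  exact (hm.sub (UnaryComputable.length PolyComputable.id.head).succ).succ.node
    ((polyComputable_uniformMetric hm _ _).node (.map (h := fun _ T => ofList (T.toList.map fun b =>
      if b.toBool then ofNNRat 1 else ofNNRat 0)) hweights PolyComputable.id.tail))

variable {m n : ℕ} (S : Fin m → Finset (Fin n)) (s : ℕ)

theorem toClustering_encodeMinUnion (hm : 1 ≤ m) :
    toClustering (encodeMinUnion S s) = (clusteringInstance S s hm).encode := by
  simp only [toClustering, encodeMinUnion, Instance.encode, head_node, tail_node, toList_ofList,
    toList_ofUnary, List.length_replicate, List.length_map, List.length_finRange, List.map_map,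
    ofFinset, Function.comp_def, toBool_ofBool, decide_eq_true_eq, ← List.map_coe_finRange_eq_range,
    Fin.val_inj, apply_ite ofNNRat]

/-! ### Reading off the answer -/

/-- The sets that are selected by the set of centers with code `y`, that is, whose entry in `y` is
false. -/
def selectedSets (x y : Data) : Data :=
  ofList (((List.zipWith .node x.tail.toList y.toList).filter fun z => ¬ z.tail.toBool).map head)

/-- The entrywise disjunction, which encodes the union of two sets. -/
def disjunction (a b : Data) : Data :=
  ofList (List.zipWith (fun a b => ofBool (a.toBool || b.toBool)) a.toList b.toList)

/-- The union of the selected sets; the fold starts with the empty set. -/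
def selectedUnion (x y : Data) : Data :=
  (selectedSets x y).toList.foldl disjunction (ofList (x.tail.head.toList.map fun _ => .nil))

/-- The test for being dense, for an input `x` of Min `s`-Union and the code `y` of a set of
centers: some set has more than `n / s` elements, or at least `s` sets are selected and their union
has less than `n / 4` elements. -/
def LooksDense (x y : Data) : Prop :=
  (∃ T ∈ x.tail.toList, T.toList.length < x.head.toList.length * T.trueCount) ∨
    x.head.toList.length ≤ (selectedSets x y).toList.length ∧
      4 * (selectedUnion x y).trueCount < (selectedUnion x y).toList.length

theorem polyComputable_selectedSets : PolyComputable fun z => selectedSets z.tail z.head := by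
  have hpairs := PolyComputable.filter (p := fun _ z => ¬ z.tail.toBool)
    (PolyDecidable.of_toBool PolyComputable.id.tail.tail).not
    (PolyComputable.zip PolyComputable.id.tail.tail PolyComputable.id.head)
  refine (PolyComputable.map (h := fun _ z => z.head) PolyComputable.id.tail.head hpairs).of_eq
    fun z => ?_
  simp only [selectedSets, toList_ofList]

theorem size_disjunction_le (a b : Data) : (disjunction a b).size ≤ 4 * b.size := by
  have hlen := length_toList_lt_size b
  have hsum := List.sum_le_card_nsmul ((List.zipWith (fun a b => ofBool (a.toBool || b.toBool))
    a.toList b.toList).map fun c => c.size + 1) 4 fun k hk => by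
      obtain ⟨c, hc, rfl⟩ := List.mem_map.1 hk
      obtain ⟨i, hi, rfl⟩ := List.mem_iff_getElem.1 hc
      rw [List.getElem_zipWith]
      exact Nat.succ_le_succ (size_ofBool_le _)
  simp only [List.length_map, List.length_zipWith, smul_eq_mul] at hsum
  rw [disjunction, size_ofList]
  omega

theorem polyComputable_selectedUnion : PolyComputable fun z => selectedUnion z.tail z.head := by
  have hor : PolyComputable fun z => ofBool (z.head.toBool || z.tail.toBool) := by
    refine ((PolyDecidable.of_toBool PolyComputable.id.head).or
      (.of_toBool PolyComputable.id.tail)).polyComputable_ofBool.of_eq fun z => ?_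
    simp only [Bool.decide_or, Bool.decide_eq_true]
  have hdisj : PolyComputable fun z => disjunction z.tail.head z.tail.tail :=
    PolyComputable.zipWith (h := fun a b => ofBool (a.toBool || b.toBool)) hor
      PolyComputable.id.tail.head PolyComputable.id.tail.tail
  refine PolyComputable.foldl (g := fun _ => disjunction) hdisj polyComputable_selectedSets
    (.map (h := fun _ _ => .nil) (.const .nil) PolyComputable.id.tail.tail.head)
    ((PolyBounded.const 4).mul polyComputable_selectedSets.polyBounded_size) fun z a ha y => ?_
  have := size_disjunction_le y a
  have := size_lt_of_mem_toList ha
  omega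

theorem polyDecidable_looksDense : PolyDecidable fun z => LooksDense z.tail z.head := by
  have hs : UnaryComputable fun z => z.tail.head.toList.length :=
    .length PolyComputable.id.tail.head
  have hlarge : PolyDecidable fun z =>
      z.tail.toList.length < z.head.tail.head.toList.length * z.tail.trueCount :=
    (UnaryComputable.length PolyComputable.id.tail).lt
      ((UnaryComputable.length PolyComputable.id.head.tail.head).mul
        (.trueCount PolyComputable.id.tail))
  exact (PolyDecidable.exists_mem
    (p := fun z T => T.toList.length < z.tail.head.toList.length * T.trueCount)
    hlarge PolyComputable.id.tail.tail).or
      ((hs.le (.length polyComputable_selectedSets)).and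
        (((UnaryComputable.const 4).mul (.trueCount polyComputable_selectedUnion)).lt
          (.length polyComputable_selectedUnion)))

theorem length_toList_ofFinset (A : Finset (Fin n)) : (ofFinset A).toList.length = n := by
  rw [ofFinset, toList_ofList, List.length_map, List.length_finRange]

theorem trueCount_ofFinset (A : Finset (Fin n)) : (ofFinset A).trueCount = A.card := by
  simp only [trueCount, ofFinset, toList_ofList, List.countP_map, Function.comp_def, toBool_ofBool]
  rw [List.countP_eq_length_filter, ← List.toFinset_card_of_nodup
    ((List.nodup_finRange n).filter _)]
  congr 1
  ext i
  simp

theorem disjunction_ofFinset (A B : Finset (Fin n)) :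
    disjunction (ofFinset A) (ofFinset B) = ofFinset (A ∪ B) := by
  simp only [disjunction, ofFinset, toList_ofList, List.zipWith_map, List.zipWith_self,
    toBool_ofBool, Finset.mem_union, Bool.decide_or]

theorem foldl_disjunction_ofFinset (L : List (Fin m)) (A : Finset (Fin n)) :
    (L.map fun j => ofFinset (S j)).foldl disjunction (ofFinset A) =
      ofFinset (A ∪ L.toFinset.biUnion S) := by
  induction L generalizing A with
  | nil => simp
  | cons j L ih =>
    rw [List.map_cons, List.foldl_cons, disjunction_ofFinset, ih, List.toFinset_cons,
      Finset.biUnion_insert, Finset.union_assoc]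

variable {S s}

theorem selectedUnion_encodeMinUnion (hm : 1 ≤ m) {y : Data} {L : List (Fin m)}
    (hL : selectedSets (encodeMinUnion S s) y = ofList (L.map fun j => ofFinset (S j))) :
    selectedUnion (encodeMinUnion S s) y = ofFinset (L.toFinset.biUnion S) := by
  obtain ⟨m, rfl⟩ := Nat.exists_eq_add_of_le' hm
  have hempty : ofList ((encodeMinUnion S s).tail.head.toList.map fun _ => .nil) =
      ofFinset (∅ : Finset (Fin n)) := by
    simp [encodeMinUnion, List.finRange_succ, ofFinset, Function.comp_def,
      show ofBool false = nil from rfl]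
  rw [selectedUnion, hL, hempty, toList_ofList, foldl_disjunction_ofFinset, Finset.empty_union]

theorem looksDense_encodeMinUnion_iff (hm : 1 ≤ m) {y : Data} {L : List (Fin m)} (hL' : L.Nodup)
    (hL : selectedSets (encodeMinUnion S s) y = ofList (L.map fun j => ofFinset (S j))) :
    LooksDense (encodeMinUnion S s) y ↔ (∃ j, n < s * (S j).card) ∨
      s ≤ L.toFinset.card ∧ 4 * (L.toFinset.biUnion S).card < n := by
  rw [LooksDense, selectedUnion_encodeMinUnion hm hL, hL, trueCount_ofFinset,
    length_toList_ofFinset, List.toFinset_card_of_nodup hL']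
  simp [encodeMinUnion, length_toList_ofFinset, trueCount_ofFinset]

theorem looksDense_ofFinset_iff (hm : 1 ≤ m) (C : Finset (Fin m)) :
    LooksDense (encodeMinUnion S s) (ofFinset C) ↔ (∃ j, n < s * (S j).card) ∨
      s ≤ Cᶜ.card ∧ 4 * (Cᶜ.biUnion S).card < n := by
  have hC : ((List.finRange m).filter (· ∉ C)).toFinset = Cᶜ := by ext j; simp
  rw [looksDense_encodeMinUnion_iff hm ((List.nodup_finRange m).filter (· ∉ C)), hC]
  simp [selectedSets, encodeMinUnion, ofFinset, List.zipWith_map, List.zipWith_self,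
    List.filter_map, Function.comp_def]

theorem exists_of_looksDense (hm : 1 ≤ m) {y : Data} (h : LooksDense (encodeMinUnion S s) y) :
    (∃ j, n < s * (S j).card) ∨
      ∃ J : Finset (Fin m), s ≤ J.card ∧ 4 * (J.biUnion S).card < n := by
  have hsub : List.Sublist (selectedSets (encodeMinUnion S s) y).toList
      ((List.finRange m).map fun j => ofFinset (S j)) := by
    have hprefix (A B : List Data) : (List.zipWith node A B).map head <+: A := by
      induction A generalizing B with
      | nil => simp
      | cons a A ih => cases B with
        | nil => simp
        | cons b B => exact List.prefix_cons_iff.2 (.inr ⟨_, rfl, ih B⟩)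
    rw [selectedSets, toList_ofList]
    exact (List.filter_sublist.map head).trans <| (hprefix _ _).sublist.trans <| by
      simp [encodeMinUnion]
  obtain ⟨L, hLm, hL⟩ := List.sublist_map_iff.1 hsub
  have hnodup := (List.nodup_finRange m).sublist hLm
  exact ((looksDense_encodeMinUnion_iff hm hnodup (by rw [← hL, ofList_toList])).1 h).imp_right
    fun h => ⟨_, h⟩

end Encoding

/-! ### The cost of a set of centers -/

theorem sum_rpow_le_card_rpow_mul_rpow_sum {ι : Type*} (T : Finset ι) {f : ι → ℝ}
    (hf : ∀ i, 0 ≤ f i) {a : ℝ} (ha0 : 0 < a) (ha1 : a ≤ 1) :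
    ∑ i ∈ T, f i ^ a ≤ (T.card : ℝ) ^ (1 - a) * (∑ i ∈ T, f i) ^ a := by
  have h := Real.inner_le_weight_mul_Lp_of_nonneg T ((one_le_inv₀ ha0).2 ha1) (fun _ => 1)
    (fun i => f i ^ a) (fun _ => zero_le_one) fun i => Real.rpow_nonneg (hf i) a
  simpa only [one_mul, Finset.sum_const, nsmul_eq_mul, mul_one, inv_inv,
    Real.rpow_rpow_inv (hf _) ha0.ne'] using h

namespace Instance

theorem cost_nonneg (I : Instance) (p q : ℝ) (C : Finset (Fin I.m)) : 0 ≤ I.cost p q C :=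
  Real.rpow_nonneg (Finset.sum_nonneg fun _ _ => Real.rpow_nonneg (Real.rpow_nonneg
    (Finset.sum_nonneg fun _ _ => mul_nonneg (NNRat.cast_nonneg _) (Real.rpow_nonneg
      (Real.iInf_nonneg fun _ => NNRat.cast_nonneg _) _)) _) _) _

theorem IsApprox.mono {I : Instance} {p q ρ ρ' : ℝ} {C : Finset (Fin I.m)}
    (hC : I.IsApprox p q ρ C) (h : ρ ≤ ρ') : I.IsApprox p q ρ' C :=
  ⟨hC.1, fun C' hC' => (hC.2 C' hC').trans
    (mul_le_mul_of_nonneg_right h (I.cost_nonneg p q C'))⟩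

theorem IsApprox.nonempty {I : Instance} {p q ρ : ℝ} {C : Finset (Fin I.m)}
    (hC : I.IsApprox p q ρ C) : C.Nonempty :=
  Finset.card_pos.1 (hC.1 ▸ I.one_le_k)

end Instance

section Cost

variable {m n : ℕ} (S : Fin m → Finset (Fin n)) {s : ℕ}

/-- The number of sets outside `C` that contain `i`. -/
def uncoveredDegree (C : Finset (Fin m)) (i : Fin n) : ℕ := (Cᶜ.filter fun j => i ∈ S j).card

theorem sum_uncoveredDegree {C : Finset (Fin m)} {T : Finset (Fin n)} (hT : ∀ j ∈ Cᶜ, S j ⊆ T) :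
    ∑ i ∈ T, uncoveredDegree S C i = ∑ j ∈ Cᶜ, (S j).card := by
  simp only [uncoveredDegree, Finset.card_filter]
  rw [Finset.sum_comm]
  refine Finset.sum_congr rfl fun j hj => ?_
  rw [← Finset.card_filter, Finset.filter_mem_eq_inter, Finset.inter_eq_right.2 (hT j hj)]

theorem uncoveredDegree_eq_zero {C : Finset (Fin m)} {i : Fin n} (hi : ∀ j ∈ Cᶜ, i ∉ S j) :
    uncoveredDegree S C i = 0 :=
  Finset.card_eq_zero.2 (Finset.filter_eq_empty_iff.2 @hi)

theorem distTo_clusteringInstance (hm : 1 ≤ m) {C : Finset (Fin m)} (hC : C.Nonempty) (j : Fin m) :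
    (clusteringInstance S s hm).distTo j C = if j ∈ C then 0 else 1 := by
  have : Nonempty C := hC.to_subtype
  unfold Instance.distTo
  split_ifs with hj
  · refine le_antisymm ?_ (Real.iInf_nonneg fun c => NNRat.cast_nonneg _)
    refine (ciInf_le ⟨0, ?_⟩ ⟨j, hj⟩).trans (by simp)
    rintro _ ⟨c, rfl⟩
    exact NNRat.cast_nonneg _
  · have hdist (c : C) : (((clusteringInstance S s hm).d j c : NNRat) : ℝ) = 1 := by
      simp [ne_of_mem_of_not_mem c.2 hj |>.symm]
    simp only [hdist, ciInf_const]

theorem groupCost_clusteringInstance (hm : 1 ≤ m) {C : Finset (Fin m)} (hC : C.Nonempty) {p : ℝ}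
    (hp : 0 < p) (i : Fin n) :
    (clusteringInstance S s hm).groupCost p C i = (uncoveredDegree S C i : ℝ) ^ (1 / p) := by
  have hterm (j : Fin m) : (((clusteringInstance S s hm).w i j : NNRat) : ℝ) *
      (clusteringInstance S s hm).distTo j C ^ p = if j ∈ Cᶜ ∧ i ∈ S j then 1 else 0 := by
    rw [distTo_clusteringInstance S hm hC]
    by_cases hj : j ∈ C <;> by_cases hi : i ∈ S j <;> simp [hj, hi, Real.zero_rpow hp.ne']
  rw [Instance.groupCost, Finset.sum_congr rfl fun j _ => hterm j, Finset.sum_boole,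
    ← Finset.filter_filter, Finset.filter_univ_mem, uncoveredDegree]

theorem cost_rpow_clusteringInstance (hm : 1 ≤ m) {C : Finset (Fin m)} (hC : C.Nonempty) {p q : ℝ}
    (hp : 0 < p) (hq : q ≠ 0) : (clusteringInstance S s hm).cost p q C ^ q =
      ∑ i : Fin n, (uncoveredDegree S C i : ℝ) ^ (q / p) := by
  simp only [Instance.cost, groupCost_clusteringInstance S hm hC hp]
  rw [one_div q, Real.rpow_inv_rpow (by positivity) hq]
  refine Finset.sum_congr rfl fun i _ => ?_
  rw [← Real.rpow_mul (by positivity), one_div_mul_eq_div]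

theorem card_biUnion_le_cost_rpow (hm : 1 ≤ m) {C : Finset (Fin m)} (hC : C.Nonempty) {p q : ℝ}
    (hp : 0 < p) (hq : 0 < q) :
    ((Cᶜ.biUnion S).card : ℝ) ≤ (clusteringInstance S s hm).cost p q C ^ q := by
  rw [cost_rpow_clusteringInstance S hm hC hp hq.ne', Finset.card_eq_sum_ones, Nat.cast_sum]
  refine (Finset.sum_le_sum fun i hi => ?_).trans
    (Finset.sum_le_sum_of_subset_of_nonneg (Finset.subset_univ _) fun i _ _ => by positivity)
  obtain ⟨j, hj, hij⟩ := Finset.mem_biUnion.1 hi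
  have hone : 1 ≤ uncoveredDegree S C i := Finset.card_pos.2 ⟨j, Finset.mem_filter.2 ⟨hj, hij⟩⟩
  rw [Nat.cast_one]
  exact Real.one_le_rpow (by exact_mod_cast hone) (by positivity)

theorem cost_rpow_le (hm : 1 ≤ m) {C : Finset (Fin m)} (hC : C.Nonempty) {p q : ℝ} (hq : 0 < q)
    (hqp : q ≤ p) {T : Finset (Fin n)} (hT : ∀ j ∈ Cᶜ, S j ⊆ T) :
    (clusteringInstance S s hm).cost p q C ^ q ≤
      (T.card : ℝ) ^ (1 - q / p) * ((∑ j ∈ Cᶜ, (S j).card : ℕ) : ℝ) ^ (q / p) := by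
  have hp : 0 < p := hq.trans_le hqp
  rw [cost_rpow_clusteringInstance S hm hC hp hq.ne', ← sum_uncoveredDegree S hT, Nat.cast_sum,
    ← Finset.sum_subset (Finset.subset_univ T)]
  · exact sum_rpow_le_card_rpow_mul_rpow_sum T (fun i => Nat.cast_nonneg _) (by positivity)
      ((div_le_one hp).2 hqp)
  · intro i _ hi
    rw [uncoveredDegree_eq_zero S fun j hj hij => hi (hT j hj hij), Nat.cast_zero,
      Real.zero_rpow (by positivity)]

theorem sum_card_le_of_mul_card_le {J : Finset (Fin m)} (hJ : J.card = s)
    (hsn : ∀ j, s * (S j).card ≤ n) : ∑ j ∈ J, (S j).card ≤ n := by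
  rcases Nat.eq_zero_or_pos s with rfl | hs
  · rw [Finset.card_eq_zero.1 hJ, Finset.sum_empty]
    exact Nat.zero_le n
  · calc ∑ j ∈ J, (S j).card ≤ J.card • (n / s) := Finset.sum_le_card_nsmul J _ _ fun j _ => by
          rw [Nat.le_div_iff_mul_le hs, mul_comm]; exact hsn j
      _ ≤ n := by rw [hJ, smul_eq_mul]; exact Nat.mul_div_le n s

theorem card_biUnion_le_of_isApprox (hs : s < m) {p q ρ : ℝ} (hq : 0 < q) (hqp : q ≤ p)
    (hρ : 0 ≤ ρ) {C : Finset (Fin m)}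
    (hC : (clusteringInstance S s (Nat.one_le_of_lt hs)).IsApprox p q ρ C) {J : Finset (Fin m)}
    {T : Finset (Fin n)} (hJ : J.card = s) (hJT : ∀ j ∈ J, S j ⊆ T)
    (hsn : ∀ j, s * (S j).card ≤ n) :
    ((Cᶜ.biUnion S).card : ℝ) ≤ ρ ^ q * ((T.card : ℝ) ^ (1 - q / p) * (n : ℝ) ^ (q / p)) := by
  have hp : 0 < p := hq.trans_le hqp
  have hJc : Jᶜ.card = m - s := by rw [Finset.card_compl, hJ, Fintype.card_fin]
  have hJk : Jᶜ.card = m - (s + 1) + 1 := by omega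
  have hJne : Jᶜ.Nonempty := Finset.card_pos.1 (by omega)
  have hsum : ((∑ j ∈ Jᶜᶜ, (S j).card : ℕ) : ℝ) ≤ n := by
    rw [compl_compl]; exact_mod_cast sum_card_le_of_mul_card_le S hJ hsn
  set I := clusteringInstance S s (Nat.one_le_of_lt hs)
  have hopt : I.cost p q Jᶜ ^ q ≤ (T.card : ℝ) ^ (1 - q / p) * (n : ℝ) ^ (q / p) :=
    (cost_rpow_le S _ hJne hq hqp (by rwa [compl_compl])).trans <|
      mul_le_mul_of_nonneg_left (Real.rpow_le_rpow (Nat.cast_nonneg _) hsum (by positivity))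
        (by positivity)
  calc ((Cᶜ.biUnion S).card : ℝ)
      ≤ I.cost p q C ^ q := card_biUnion_le_cost_rpow S _ hC.nonempty hp hq
    _ ≤ (ρ * I.cost p q Jᶜ) ^ q :=
        Real.rpow_le_rpow (I.cost_nonneg _ _ _) (hC.2 Jᶜ hJk) hq.le
    _ = ρ ^ q * I.cost p q Jᶜ ^ q := Real.mul_rpow hρ (I.cost_nonneg _ _ _)
    _ ≤ _ := mul_le_mul_of_nonneg_left hopt (Real.rpow_nonneg hρ q)

end Cost

/-! ### Asymptotics -/

theorem tendsto_log_natCast : Tendsto (fun m : ℕ => Real.log m) atTop atTop :=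
  Real.tendsto_log_atTop.comp tendsto_natCast_atTop_atTop

theorem tendsto_natCast_rpow_mul_log {ε : ℝ} (hε : 0 < ε) :
    Tendsto (fun m : ℕ => 10 * (m : ℝ) ^ ε * Real.log m) atTop atTop :=
  (((tendsto_rpow_atTop hε).comp tendsto_natCast_atTop_atTop).const_mul_atTop
    (by norm_num : (0 : ℝ) < 10)).atTop_mul_atTop₀ tendsto_log_natCast

theorem tendsto_unionParam {ε : ℝ} (hε : 0 < ε) : Tendsto (unionParam ε) atTop atTop :=
  tendsto_nat_floor_atTop.comp ((tendsto_rpow_atTop hε).comp tendsto_natCast_atTop_atTop)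

theorem eventually_unionParam_lt {ε : ℝ} (hε : ε < 1) : ∀ᶠ m in atTop, unionParam ε m < m := by
  filter_upwards [eventually_gt_atTop 1] with m hm
  rw [unionParam, Nat.floor_lt (by positivity)]
  exact (Real.rpow_lt_rpow_of_exponent_lt (by exact_mod_cast hm) hε).trans_eq (Real.rpow_one _)

theorem unionParam_mul_drawCount_le (ε : ℝ) (m : ℕ) :
    unionParam ε m * drawCount m ≤ groundSize ε m := by
  have := Real.log_natCast_nonneg m
  refine Nat.le_floor ?_
  push_cast
  calc (unionParam ε m : ℝ) * drawCount m ≤ (m : ℝ) ^ ε * (10 * Real.log m) :=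
        mul_le_mul (Nat.floor_le (by positivity)) (Nat.floor_le (by positivity)) (by positivity)
          (by positivity)
    _ = _ := by ring

theorem rpow_mul_rpow_mul_rpow_eq {b L : ℝ} (hb : 0 < b) (hL : 0 < L) (δ a : ℝ) :
    b ^ ((1 - δ) * (1 - a)) * (((b * L) ^ δ) ^ (1 - a) * (b * L) ^ a) =
      b * L * L ^ (-((1 - δ) * (1 - a))) := by
  have hbL : 0 < b * L := mul_pos hb hL
  have hexp : (1 - δ) * (1 - a) + (δ * (1 - a) + a) = 1 := by ring
  calc b ^ ((1 - δ) * (1 - a)) * (((b * L) ^ δ) ^ (1 - a) * (b * L) ^ a)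
      = (b * L / L) ^ ((1 - δ) * (1 - a)) * (b * L) ^ (δ * (1 - a) + a) := by
        rw [mul_div_cancel_right₀ b hL.ne', ← Real.rpow_mul hbL.le, Real.rpow_add hbL]
    _ = (b * L) ^ ((1 - δ) * (1 - a) + (δ * (1 - a) + a)) * L ^ (-((1 - δ) * (1 - a))) := by
        rw [Real.div_rpow hbL.le hL.le, Real.rpow_add hbL ((1 - δ) * (1 - a)),
          Real.rpow_neg hL.le, div_mul_eq_mul_div, div_eq_mul_inv]
    _ = b * L * L ^ (-((1 - δ) * (1 - a))) := by rw [hexp, Real.rpow_one]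

theorem eventually_four_mul_lt_groundSize {ε δ a : ℝ} (hε : 0 < ε) (hδ0 : 0 ≤ δ) (hδ : δ < 1)
    (ha0 : 0 ≤ a) (ha1 : a < 1) :
    ∀ᶠ m : ℕ in atTop, 4 * (((m : ℝ) ^ ε) ^ ((1 - δ) * (1 - a)) *
      (((10 * (unionParam ε m : ℝ) * Real.log m) ^ δ) ^ (1 - a) * (groundSize ε m : ℝ) ^ a)) <
        groundSize ε m := by
  have hκ : 0 < (1 - δ) * (1 - a) := mul_pos (sub_pos.2 hδ) (sub_pos.2 ha1)
  have hdecay : Tendsto (fun m : ℕ => (10 * Real.log m) ^ (-((1 - δ) * (1 - a)))) atTop (𝓝 0) :=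
    (tendsto_rpow_neg_atTop hκ).comp (tendsto_log_natCast.const_mul_atTop (by norm_num))
  filter_upwards [hdecay.eventually_le_const (by norm_num : (0 : ℝ) < 1 / 8),
    (tendsto_natCast_rpow_mul_log hε).eventually_gt_atTop 2,
    tendsto_log_natCast.eventually_gt_atTop 0, eventually_gt_atTop 0] with m hdecay hX hlog hm
  set b := (m : ℝ) ^ ε
  set L := 10 * Real.log m with hL
  have hb0 : 0 < b := Real.rpow_pos_of_pos (Nat.cast_pos.2 hm) ε
  have hL0 : 0 < L := by positivity
  have hbL : 10 * b * Real.log m = b * L := by rw [hL]; ring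
  rw [hbL] at hX
  have hn_le : (groundSize ε m : ℝ) ≤ b * L := by
    rw [← hbL]; exact Nat.floor_le (by positivity)
  have hn_gt : b * L - 1 < groundSize ε m := by rw [← hbL]; exact Nat.sub_one_lt_floor _
  have hs : 10 * (unionParam ε m : ℝ) * Real.log m ≤ b * L := by
    rw [← hbL]; gcongr; exact Nat.floor_le hb0.le
  have : 0 ≤ 1 - a := by linarith
  calc 4 * (b ^ ((1 - δ) * (1 - a)) * (((10 * (unionParam ε m : ℝ) * Real.log m) ^ δ) ^ (1 - a) *
          (groundSize ε m : ℝ) ^ a))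
      ≤ 4 * (b ^ ((1 - δ) * (1 - a)) * (((b * L) ^ δ) ^ (1 - a) * (b * L) ^ a)) := by gcongr
    _ = 4 * (b * L * L ^ (-((1 - δ) * (1 - a)))) := by rw [rpow_mul_rpow_mul_rpow_eq hb0 hL0]
    _ ≤ 4 * (b * L * (1 / 8)) := by gcongr
    _ < groundSize ε m := by linarith

theorem eventually_mul_pow_le {ε : ℝ} (hε : 0 < ε) : ∀ᶠ m : ℕ in atTop,
    m * (m ^ unionParam ε m * 2 ^ groundSize ε m) ≤ 4 ^ (unionParam ε m * drawCount m) := by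
  filter_upwards [(tendsto_unionParam hε).eventually_ge_atTop 10,
    tendsto_log_natCast.eventually_ge_atTop 1, eventually_gt_atTop 0] with m hs hlog hm
  have hn : (groundSize ε m : ℝ) ≤ 10 * (unionParam ε m + 1) * Real.log m := by
    refine (Nat.floor_le (by positivity)).trans ?_
    gcongr
    exact (Nat.lt_floor_add_one _).le
  have hr : 10 * Real.log m - 1 ≤ drawCount m := (Nat.sub_one_lt_floor _).le
  have hlog4 : Real.log 4 = 2 * Real.log 2 := by
    rw [show (4 : ℝ) = 2 ^ 2 by norm_num, Real.log_pow, Nat.cast_ofNat]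
  suffices H : (m : ℝ) * ((m : ℝ) ^ unionParam ε m * 2 ^ groundSize ε m) ≤
      4 ^ (unionParam ε m * drawCount m) by exact_mod_cast H
  rw [← Real.log_le_log_iff (by positivity) (by positivity), Real.log_mul (by positivity)
    (by positivity), Real.log_mul (by positivity) (by positivity), Real.log_pow, Real.log_pow,
    Real.log_pow, hlog4, Nat.cast_mul]
  set s : ℝ := (unionParam ε m : ℝ)
  set x := Real.log m
  have hs' : (10 : ℝ) ≤ s := Nat.ofNat_le_cast.2 hs
  have hleft : (groundSize ε m : ℝ) * Real.log 2 ≤ 10 * (s + 1) * x * 0.7 :=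
    mul_le_mul hn (by linarith [Real.log_two_lt_d9]) (by positivity) (by positivity)
  have hright : s * (10 * x - 1) * (2 * 0.69) ≤ s * drawCount m * (2 * Real.log 2) := by
    have := Real.log_two_gt_d9
    gcongr
    linarith
  nlinarith [mul_nonneg (sub_nonneg.2 hs') (sub_nonneg.2 hlog)]

/-! ### Random inputs -/

section Random

variable {m r n : ℕ}

/-- Any `s` sets have a union of at least `n / 4` elements. -/
def Spread (s : ℕ) (S : Fin m → Finset (Fin n)) : Prop :=
  ∀ J : Finset (Fin m), s ≤ J.card → n ≤ 4 * (J.biUnion S).card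

theorem card_drawnSets_le (f : Fin m → Fin r → Fin n) (j : Fin m) : (drawnSets f j).card ≤ r :=
  Finset.card_image_le.trans (by simp)

theorem card_filter_draws_mem (J : Finset (Fin m)) (T : Finset (Fin n)) :
    (Finset.univ.filter fun f : Fin m → Fin r → Fin n => ∀ j ∈ J, ∀ l, f j l ∈ T).card =
      (T.card ^ r) ^ J.card * (n ^ r) ^ (m - J.card) := by
  have hpi : (Finset.univ.filter fun f : Fin m → Fin r → Fin n => ∀ j ∈ J, ∀ l, f j l ∈ T) =
      Fintype.piFinset fun j => if j ∈ J then Fintype.piFinset fun _ => T else Finset.univ := by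
    ext f
    simp only [Finset.mem_filter, Finset.mem_univ, true_and, Fintype.mem_piFinset]
    refine forall_congr' fun j => ?_
    by_cases hj : j ∈ J <;> simp [hj]
  rw [hpi, Fintype.card_piFinset]
  simp only [apply_ite Finset.card, Fintype.card_piFinset_const, Finset.card_univ, Fintype.card_fun,
    Fintype.card_fin]
  rw [Finset.prod_ite, Finset.prod_const, Finset.prod_const, Finset.filter_not,
    Finset.filter_univ_mem, ← Finset.compl_eq_univ_sdiff, Finset.card_compl, Fintype.card_fin]

theorem card_filter_draws_mem_mul_le (J : Finset (Fin m)) {T : Finset (Fin n)}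
    (hT : 4 * T.card ≤ n) :
    (Finset.univ.filter fun f : Fin m → Fin r → Fin n => ∀ j ∈ J, ∀ l, f j l ∈ T).card *
      4 ^ (J.card * r) ≤ Fintype.card (Fin m → Fin r → Fin n) := by
  have hJ : J.card ≤ m := (Finset.card_le_univ J).trans_eq (Fintype.card_fin m)
  rw [card_filter_draws_mem]
  calc (T.card ^ r) ^ J.card * (n ^ r) ^ (m - J.card) * 4 ^ (J.card * r)
      = ((4 * T.card) ^ r) ^ J.card * (n ^ r) ^ (m - J.card) := by
        rw [mul_pow, mul_pow, ← pow_mul 4, mul_comm r]; ring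
    _ ≤ (n ^ r) ^ J.card * (n ^ r) ^ (m - J.card) := by gcongr
    _ = Fintype.card (Fin m → Fin r → Fin n) := by
        rw [← pow_add, Nat.add_sub_cancel' hJ]; simp

open Classical in
theorem card_not_spread_mul_le (s : ℕ) :
    (Finset.univ.filter fun f : Fin m → Fin r → Fin n => ¬ Spread s (drawnSets f)).card *
      4 ^ (s * r) ≤ m ^ s * 2 ^ n * Fintype.card (Fin m → Fin r → Fin n) := by
  set P := (Finset.powersetCard s (Finset.univ : Finset (Fin m))) ×ˢ
    (Finset.univ.filter fun T : Finset (Fin n) => 4 * T.card < n) with hP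
  set draws := fun x : Finset (Fin m) × Finset (Fin n) =>
    Finset.univ.filter fun f : Fin m → Fin r → Fin n => ∀ j ∈ x.1, ∀ l, f j l ∈ x.2
  have hsub : (Finset.univ.filter fun f : Fin m → Fin r → Fin n => ¬ Spread s (drawnSets f)) ⊆
      P.biUnion draws := by
    intro f hf
    simp only [Spread, Finset.mem_filter, Finset.mem_univ, true_and, not_forall, not_le] at hf
    obtain ⟨J, hJ, hJn⟩ := hf
    obtain ⟨J', hJ', rfl⟩ := Finset.exists_subset_card_eq hJ
    refine Finset.mem_biUnion.2 ⟨(J', J.biUnion (drawnSets f)), by simp [hP, hJn], ?_⟩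
    exact Finset.mem_filter.2 ⟨Finset.mem_univ f, fun j hj l =>
      Finset.mem_biUnion.2 ⟨j, hJ' hj, Finset.mem_image_of_mem _ (Finset.mem_univ l)⟩⟩
  have hPcard : P.card ≤ m ^ s * 2 ^ n := by
    rw [hP, Finset.card_product, Finset.card_powersetCard, Finset.card_univ, Fintype.card_fin]
    exact Nat.mul_le_mul (Nat.choose_le_pow m s) ((Finset.card_le_univ _).trans (by simp))
  calc _ ≤ (∑ x ∈ P, (draws x).card) * 4 ^ (s * r) :=
        Nat.mul_le_mul_right _ ((Finset.card_le_card hsub).trans Finset.card_biUnion_le)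
    _ = ∑ x ∈ P, (draws x).card * 4 ^ (s * r) := Finset.sum_mul ..
    _ ≤ P.card • Fintype.card (Fin m → Fin r → Fin n) := by
        refine Finset.sum_le_card_nsmul _ _ _ fun x hx => ?_
        obtain ⟨hJ, hT⟩ := Finset.mem_product.1 hx
        rw [← (Finset.mem_powersetCard.1 hJ).2]
        exact card_filter_draws_mem_mul_le x.1 (Finset.mem_filter.1 hT).2.le
    _ ≤ _ := Nat.mul_le_mul_right _ hPcard

end Random

open Classical in
theorem eventually_mul_card_not_spread_le {ε : ℝ} (hε : 0 < ε) : ∀ᶠ m : ℕ in atTop,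
    (Finset.univ.filter fun f : Fin m → Fin (drawCount m) → Fin (groundSize ε m) =>
      ¬ Spread (unionParam ε m) (drawnSets f)).card * m ≤
        Fintype.card (Fin m → Fin (drawCount m) → Fin (groundSize ε m)) := by
  filter_upwards [eventually_mul_pow_le hε] with m hpow
  have hbad := card_not_spread_mul_le (m := m) (r := drawCount m) (n := groundSize ε m)
    (unionParam ε m)
  set bad := (Finset.univ.filter fun f : Fin m → Fin (drawCount m) → Fin (groundSize ε m) =>
    ¬ Spread (unionParam ε m) (drawnSets f)).card
  set total := Fintype.card (Fin m → Fin (drawCount m) → Fin (groundSize ε m))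
  refine Nat.le_of_mul_le_mul_right ?_ (pow_pos four_pos (unionParam ε m * drawCount m))
  calc bad * m * 4 ^ (unionParam ε m * drawCount m)
      = m * (bad * 4 ^ (unionParam ε m * drawCount m)) := by ring
    _ ≤ m * (m ^ unionParam ε m * 2 ^ groundSize ε m * total) := Nat.mul_le_mul_left m hbad
    _ = m * (m ^ unionParam ε m * 2 ^ groundSize ε m) * total := (mul_assoc ..).symm
    _ ≤ 4 ^ (unionParam ε m * drawCount m) * total := Nat.mul_le_mul_right total hpow
    _ = total * 4 ^ (unionParam ε m * drawCount m) := mul_comm ..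

instance : IsProbabilityMeasure coinMeasure := by
  unfold coinMeasure; infer_instance

theorem randomRejectProb_le_one (c : Program) (ε : ℝ) (s : ℕ → ℕ) (m : ℕ) :
    randomRejectProb c ε s m ≤ 1 := by
  refine div_le_one_of_le₀ ?_ (Nat.cast_nonneg _)
  exact (Finset.sum_le_card_nsmul _ _ 1 fun f _ => measureReal_le_one).trans (by simp)

open Classical in
theorem one_sub_card_not_div_card_le {F : Type*} [Fintype F] [Nonempty F] {A : F → Prop} {g : F → ℝ}
    (hg : ∀ f, 0 ≤ g f) (hA : ∀ f, A f → 1 ≤ g f) :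
    1 - ((Finset.univ.filter fun f => ¬ A f).card : ℝ) / Fintype.card F ≤
      (∑ f, g f) / Fintype.card F := by
  have htotal : (0 : ℝ) < Fintype.card F := Nat.cast_pos.2 Fintype.card_pos
  have hsplit : ((Finset.univ.filter fun f => A f).card : ℝ) +
      (Finset.univ.filter fun f => ¬ A f).card = Fintype.card F := by
    exact_mod_cast Finset.card_filter_add_card_filter_not A
  have hgood : ((Finset.univ.filter fun f => A f).card : ℝ) ≤ ∑ f, g f := by
    rw [Finset.card_eq_sum_ones, Nat.cast_sum]
    refine (Finset.sum_le_sum fun f hf => ?_).trans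
      (Finset.sum_le_sum_of_subset_of_nonneg (Finset.subset_univ _) fun f _ _ => hg f)
    exact Nat.cast_one.trans_le (hA f (Finset.mem_filter.1 hf).2)
  rw [one_sub_div htotal.ne', ← eq_sub_of_add_eq hsplit]
  exact div_le_div_of_nonneg_right hgood htotal.le

theorem tendsto_randomRejectProb {c : Program} {ε : ℝ} (hε : 0 < ε)
    (h : ∀ᶠ m in atTop, ∀ f : Fin m → Fin (drawCount m) → Fin (groundSize ε m),
      Spread (unionParam ε m) (drawnSets f) →
      ∀ ω, Rejects c (encodeMinUnion (drawnSets f) (unionParam ε m)) ω) :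
    Tendsto (randomRejectProb c ε (unionParam ε)) atTop (𝓝 1) := by
  classical
  have hlow : Tendsto (fun m : ℕ => 1 - 1 / (m : ℝ)) atTop (𝓝 1) := by
    simpa only [sub_zero] using
      (tendsto_const_nhds (x := (1 : ℝ))).sub (tendsto_one_div_atTop_nhds_zero_nat (𝕜 := ℝ))
  refine tendsto_of_tendsto_of_tendsto_of_le_of_le' hlow tendsto_const_nhds ?_
    (Eventually.of_forall fun m => randomRejectProb_le_one _ _ _ _)
  filter_upwards [h, eventually_mul_card_not_spread_le hε, eventually_gt_atTop 0,
    (tendsto_natCast_rpow_mul_log hε).eventually_ge_atTop 1] with m hrej hbad hm hn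
  have : NeZero (groundSize ε m) := ⟨(Nat.floor_pos.2 hn).ne'⟩
  refine le_trans ?_ (one_sub_card_not_div_card_le (fun _ => measureReal_nonneg) fun f hf =>
    (probReal_univ (μ := coinMeasure)).symm.trans_le (measureReal_mono fun ω _ => hrej f hf ω))
  refine sub_le_sub_left (div_le_of_le_mul₀ (Nat.cast_nonneg _) (by positivity) ?_) 1
  rw [one_div_mul_eq_div, le_div_iff₀ (Nat.cast_pos.2 hm)]
  exact_mod_cast hbad

/-! ### Hardness -/

theorem Approximates.exists_isApprox {c : Program} {p q : ℝ} {ρ : ℕ → ℝ}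
    (hc : Approximates c p q ρ) (I : Instance) :
    ∃ C : Finset (Fin I.m), I.IsApprox p q (ρ I.m) C := by
  by_contra! hno
  have h := hc.2 I
  simp only [hno, false_and, exists_false, Set.ofPred_false, measureReal_empty] at h
  norm_num at h

theorem not_approximates_of_eventually_lt_one {p q : ℝ} (hp : 0 < p) (hq : 0 < q) {ρ : ℕ → ℝ}
    (hρ : ∀ᶠ m in atTop, ρ m < 1) (c : Program) : ¬ Approximates c p q ρ := by
  intro hc
  obtain ⟨m, hρm, hm⟩ := (hρ.and (eventually_ge_atTop 2)).exists
  set S : Fin m → Finset (Fin 1) := fun _ => Finset.univ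
  have hm1 : 1 ≤ m := by omega
  obtain ⟨C, hC⟩ := hc.exists_isApprox (clusteringInstance S 1 hm1)
  have hcard : Finset.card (α := Fin m) C = m - (1 + 1) + 1 := hC.1
  obtain ⟨j, hj⟩ : (Compl.compl (α := Finset (Fin m)) C).Nonempty :=
    Finset.card_pos.1 (by rw [Finset.card_compl, Fintype.card_fin]; omega)
  have hcost : (clusteringInstance S 1 hm1).cost p q C = 0 := by
    have hle := hC.2 C hC.1
    have hnonneg := (clusteringInstance S 1 hm1).cost_nonneg p q C
    change ρ m < 1 at hρm
    nlinarith
  have hunion := card_biUnion_le_cost_rpow S (s := 1) hm1 hC.nonempty hp hq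
  rw [hcost, Real.zero_rpow hq.ne'] at hunion
  have hpos : 0 < (Finset.biUnion (Compl.compl (α := Finset (Fin m)) C) S).card :=
    Finset.card_pos.2 ⟨0, Finset.mem_biUnion.2 ⟨j, hj, Finset.mem_univ _⟩⟩
  exact absurd hunion (not_le.2 (Nat.cast_pos.2 hpos))

theorem eventually_looksDense_of_isDense {p q ε δ : ℝ} (hq : 0 < q) (hqp : q < p) (hε : 0 < ε)
    (hε1 : ε < 1) (hδ0 : 0 ≤ δ) (hδ : δ < 1) {ρ : ℕ → ℝ}
    (hρ : ∀ᶠ m : ℕ in atTop, ρ m < (m : ℝ) ^ (ε * (1 - δ) * (p - q) / (p * q))) :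
    ∀ᶠ m : ℕ in atTop, ∀ (hm : 1 ≤ m) (S : Fin m → Finset (Fin (groundSize ε m))),
      IsDense δ (unionParam ε m) S → ∀ C : Finset (Fin m),
        (clusteringInstance S (unionParam ε m) hm).IsApprox p q (ρ m) C →
          LooksDense (encodeMinUnion S (unionParam ε m)) (Data.ofFinset C) := by
  have hp : 0 < p := hq.trans hqp
  have ha : q / p < 1 := (div_lt_one hp).2 hqp
  filter_upwards [hρ, eventually_unionParam_lt hε1,
    eventually_four_mul_lt_groundSize hε hδ0 hδ (by positivity) ha]
    with m hρm hsm hbound hm S ⟨J, T, hJ, hT, hJT⟩ C hC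
  refine (looksDense_ofFinset_iff hm C).2 (or_iff_not_imp_left.2 fun hsmall => ?_)
  push Not at hsmall
  have hcard : C.card = m - (unionParam ε m + 1) + 1 := hC.1
  refine ⟨by rw [Finset.card_compl, hcard, Fintype.card_fin]; omega, ?_⟩
  have hf : ((m : ℝ) ^ (ε * (1 - δ) * (p - q) / (p * q))) ^ q =
      ((m : ℝ) ^ ε) ^ ((1 - δ) * (1 - q / p)) := by
    rw [← Real.rpow_mul (Nat.cast_nonneg m), ← Real.rpow_mul (Nat.cast_nonneg m)]
    congr 1
    field_simp
  have hunion := card_biUnion_le_of_isApprox S hsm hq hqp.le (by positivity) (hC.mono hρm.le)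
    hJ hJT hsmall
  rw [hf] at hunion
  have : 0 ≤ 1 - q / p := by linarith
  have hreal : 4 * ((Cᶜ.biUnion S).card : ℝ) < groundSize ε m :=
    (mul_le_mul_of_nonneg_left (hunion.trans (by gcongr)) zero_le_four).trans_lt hbound
  exact_mod_cast hreal

theorem not_looksDense_of_spread {ε : ℝ} {m : ℕ} (hm : 1 ≤ m)
    {f : Fin m → Fin (drawCount m) → Fin (groundSize ε m)}
    (hf : Spread (unionParam ε m) (drawnSets f)) (y : Data) :
    ¬ LooksDense (encodeMinUnion (drawnSets f) (unionParam ε m)) y := by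
  intro h
  rcases exists_of_looksDense hm h with ⟨j, hj⟩ | ⟨J, hJ, hlt⟩
  · exact hj.not_ge ((Nat.mul_le_mul_left _ (card_drawnSets_le f j)).trans
      (unionParam_mul_drawCount_le ε m))
  · exact hlt.not_ge (hf J hJ)

theorem PolyTimeOn.exists_decision {c : Program} (hc : PolyTimeOn c (Set.range Instance.encode)) :
    ∃ d : Program, (c.Deterministic → d.Deterministic) ∧ PolyTimeOn d minUnionInputs ∧
      ∀ {m n : ℕ} (S : Fin m → Finset (Fin n)) (s : ℕ) (hm : 1 ≤ m) (ω : ℕ → Bool) (y : Data),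
        Outputs c (clusteringInstance S s hm).encode ω y →
          (LooksDense (encodeMinUnion S s) y → Accepts d (encodeMinUnion S s) ω) ∧
            (¬ LooksDense (encodeMinUnion S s) y → Rejects d (encodeMinUnion S s) ω) := by
  classical
  obtain ⟨d, hdet, hpoly, hd⟩ := hc.exists_reduction polyComputable_toClustering
    polyDecidable_looksDense.polyComputable_ofBool (X := minUnionInputs) (by
      rintro _ ⟨m, n, s, S, hs, hsm, rfl⟩
      exact ⟨_, (toClustering_encodeMinUnion S s (hs.trans hsm)).symm⟩)
  refine ⟨d, hdet, hpoly, fun S s hm ω y hy => ?_⟩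
  rw [← toClustering_encodeMinUnion] at hy
  have hout := hd _ ω y hy
  exact ⟨fun h => by rwa [decide_eq_true (by exact h)] at hout,
    fun h => by rwa [decide_eq_false (by exact h)] at hout⟩

theorem exists_distinguishes_of_approximates {p q ε δ : ℝ} (hq : 0 < q) (hqp : q < p) (hε : 0 < ε)
    (hε1 : ε < 1) (hδ0 : 0 ≤ δ) (hδ : δ < 1) {ρ : ℕ → ℝ}
    (hρ : ∀ᶠ m : ℕ in atTop, ρ m < (m : ℝ) ^ (ε * (1 - δ) * (p - q) / (p * q))) {c : Program}
    (hc : Approximates c p q ρ) :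
    ∃ d : Program, (c.Deterministic → d.Deterministic) ∧ Distinguishes d ε δ (unionParam ε) := by
  obtain ⟨hpoly, happ⟩ := hc
  obtain ⟨d, hdet, hdpoly, hd⟩ := hpoly.exists_decision
  refine ⟨d, hdet, hdpoly, ?_, tendsto_randomRejectProb hε ?_⟩
  · filter_upwards [eventually_looksDense_of_isDense hq hqp hε hε1 hδ0 hδ hρ,
      eventually_ge_atTop 1] with m hdense hm S hS
    refine (happ (clusteringInstance S (unionParam ε m) hm)).trans (measureReal_mono ?_)
    rintro ω ⟨C, hC, hout⟩
    exact (hd S _ hm ω _ hout).1 (hdense hm S hS C hC)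
  · filter_upwards [eventually_ge_atTop 1] with m hm f hf ω
    obtain ⟨P, hP⟩ := hpoly
    obtain ⟨y, t, hy, -⟩ := hP _ ⟨clusteringInstance (drawnSets f) (unionParam ε m) hm, rfl⟩ ω
    exact (hd _ _ hm ω y ⟨t, hy⟩).2 (not_looksDense_of_spread hm hf y)

end FairClustering

open FairClustering in
theorem mainTheorem4_general {mode : Mode} {p q ε δ : ℝ} (hq : 0 < q) (hqp : q ≤ p) (hε : 0 < ε)
    (hε1 : ε < 1) (hδ0 : 0 ≤ δ) (hδ : δ < 1)
    (hconj : DenseVersusRandom mode ε δ (unionParam ε)) :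
    HardToApproximateWithinLessThan mode p q
      (fun m : ℕ => (m : ℝ) ^ (ε * (1 - δ) * (p - q) / (p * q))) := by
  rintro ρ hρ ⟨c, hadm, hc⟩
  rcases hqp.eq_or_lt with rfl | hlt
  · simp only [sub_self, mul_zero, zero_div, Real.rpow_zero] at hρ
    exact not_approximates_of_eventually_lt_one hq hq hρ c hc
  · obtain ⟨d, hdet, hd⟩ := exists_distinguishes_of_approximates hq hlt hε hε1 hδ0 hδ hρ hc
    refine hconj ⟨d, ?_, hd⟩
    cases mode with
    | deterministic => exact hdet hadm
    | randomized => trivial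

theorem mainTheorem4 (mode : FairClustering.Mode) (p q ε δ : ℝ) (hq : 1 ≤ q) (hqp : q ≤ p)
    (hε : 0 < ε) (hεδ : ε < δ) (hδ : δ < 1) (hε2 : ε ≤ 1 / 2)
    (hconj : FairClustering.DenseVersusRandom mode ε δ (FairClustering.unionParam ε)) :
    FairClustering.HardToApproximateWithinLessThan mode p q
      (fun m : ℕ => (m : ℝ) ^ (ε * (1 - δ) * (p - q) / (p * q))) :=
  mainTheorem4_general (by linarith) hqp hε (by linarith) (by linarith) hδ hconj
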